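/- **Conventions.** Let $E$ be a finite totally ordered set and $M$ a (classical) matroid of rank $r$ with ground set $E$. An *ordered blueprint* $B=(B^\bullet,B^+,\le)$ is a commutative semiring $B^+$ with a partial order compatible with addition and multiplication, together with a multiplicative subset $B^\bullet\ni 0,1$ that generates $B^+$ as a semiring. A morphism is an order-preserving semiring homomorphism $B^+\to C^+$ mapping $B^\bullet$ into $C^\bullet$. We write $a\in B$ for $a\in B^\bullet$. The quotient $B/\!\!/\langle S\rangle$ by a set $S$ of relations $x\le y$ is obtained from the smallest preorder on $B^+$ that contains $\le$ and $S$ and is closed under addition and multiplication, by identifying $x,y$ with $x\le y\le x$. A subblueprint is given by a submonoid $C^\bullet\ni 0$ of $B^\bullet$, the subsemiring it generates, and the restricted order. $B$ is *pasteurized* if for every $a\in B$ there is a unique $b\in B$ with $0\le a+b$; the element $\epsilon$ is the one with $0\le 1+\epsilon$. A *pasture* is a pasteurized ordered blueprint with $0\ne1$ in which every element of $B^\bullet$ is $0$ or a unit, and whose order, seen as a preorder on formal sums of units, is generated by relations $0\le\sum a_i$. A *fundamental element* of $B$ is an $a\in B$ with $0\le a+b+\epsilon^i$ for some $b\in B$,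 $i\in\{0,1\}$; the *foundation* $B^{\mathrm{found}}$ is the subblueprint generated by the fundamental elements. A *weak Grassmann–Plücker function* of rank $r$ on $E$ over a pasture $F$ is a function $\Delta:\binom{E}{r}\to F$ whose support is the set of bases of a matroid on $E$ and which satisfies $$0\le \Delta(I_{1,2})\Delta(I_{3,4})+\epsilon\,\Delta(I_{1,3})\Delta(I_{2,4})+\Delta(I_{1,4})\Delta(I_{2,3})$$ for all $(r-2)$-subsets $I$ of $E$ and all $i_1<i_2<i_3<i_4$ not in $I$, where $I_{k,l}=I\cup\{i_k,i_l\}$. A *weak $F$-matroid* is a class of such functions up to multiplication by units of $F$; its underlying matroid is the one whose bases are the support of $\Delta$. The matroid $M$ is *weakly representable over $F$* if it is the underlying matroid of a weak $F$-matroid. The *weak universal pasture* of $M$ is $$k_M^w=\Big(\mathbb F_1^\pm\big[x_I^{\pm1}\,\big|\,I\text{ a basis of }M\big]/\!\!/\mathcal{P}l^w\Big)_0^{\pm},$$ where $\mathbb F_1^\pm=\{0,1,\epsilon\}/\!\!/\langle 0\le 1+\epsilon\rangle$ with $\epsilon^2=1$, $\mathcal{P}l^w$ consists of the above relations with $\Delta(I)$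 replaced by $x_I$ (and $x_I=0$ if $I$ is not a basis), $(-)_0$ is the degree-$0$ part with $\deg x_I=1$, and $(-)^\pm$ is the pasteurization, i.e. the quotient that identifies $a$ with $a'$ whenever $0\le a+b$ and $0\le a'+b$ for some $b$. The *foundation of $M$* is $k_M^f=(k_M^w)^{\mathrm{found}}$. **Theorem.** Let $M$ be a matroid and $F$ a pasture. The following are equivalent: 1. $M$ is weakly representable over $F$; 2. $M$ is weakly representable over the foundation $F^{\mathrm{found}}$ of $F$; 3. there exists a morphism $k_M^f\to F$. -/

import Mathlib

universe u v

/-- An ordered blueprint `B = (B•, B⁺, ≤)`: a commutative semiring `B⁺` (`carrier`), a partial order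
that is compatible with addition and multiplication, and a multiplicative subset `B•` (`mon`)
that contains `0` and `1` and generates `B⁺` as a semiring. -/
structure OrderedBlueprint : Type (u + 1) where
  carrier : Type u
  [semiring : CommSemiring carrier]
  [order : PartialOrder carrier]
  add_le_add' : ∀ x y z t : carrier, x ≤ y → z ≤ t → x + z ≤ y + t
  mul_le_mul' : ∀ x y z t : carrier, x ≤ y → z ≤ t → x * z ≤ y * t
  mon : Submonoid carrier
  zero_mem' : (0 : carrier) ∈ mon
  closure_mon : Subsemiring.closure (mon : Set carrier) = ⊤

namespace OrderedBlueprint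

attribute [instance] OrderedBlueprint.semiring OrderedBlueprint.order

/-- A morphism of ordered blueprints: an order preserving semiring homomorphism `B⁺ → C⁺` that maps
`B•` into `C•`. -/
structure Hom (B : OrderedBlueprint.{u}) (C : OrderedBlueprint.{v}) where
  toRingHom : B.carrier →+* C.carrier
  map_le : ∀ x y, x ≤ y → toRingHom x ≤ toRingHom y
  map_mon : ∀ a ∈ B.mon, toRingHom a ∈ C.mon

/-- `a` belongs to the unit group `B^×` of `B`. -/
def IsUnitOf (B : OrderedBlueprint.{u}) (a : B.carrier) : Prop :=
  a ∈ B.mon ∧ ∃ b ∈ B.mon, a * b = 1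

/-! ### Quotients by relations -/

/-- The smallest preorder on `B⁺` that contains `≤` and `S` and that is closed under addition and
multiplication. -/
inductive Gen (B : OrderedBlueprint.{u}) (S : B.carrier → B.carrier → Prop) :
    B.carrier → B.carrier → Prop
  | of_le {x y} : x ≤ y → Gen B S x y
  | of_rel {x y} : S x y → Gen B S x y
  | trans {x y z} : Gen B S x y → Gen B S y z → Gen B S x z
  | add {x y z t} : Gen B S x y → Gen B S z t → Gen B S (x + z) (y + t)
  | mul {x y z t} : Gen B S x y → Gen B S z t → Gen B S (x * z) (y * t)

/-- The congruence `x ≤' y` and `y ≤' x` of the preorder `≤'` generated by `≤` and `S`. -/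
def genCon (B : OrderedBlueprint.{u}) (S : B.carrier → B.carrier → Prop) : RingCon B.carrier where
  r x y := Gen B S x y ∧ Gen B S y x
  iseqv := ⟨fun _ => ⟨.of_le le_rfl, .of_le le_rfl⟩, fun h => ⟨h.2, h.1⟩,
    fun h h' => ⟨h.1.trans h'.1, h'.2.trans h.2⟩⟩
  add' h h' := ⟨h.1.add h'.1, h.2.add h'.2⟩
  mul' h h' := ⟨h.1.mul h'.1, h.2.mul h'.2⟩

/-- The partial order on `B⁺ / ≡` that is induced by the generated preorder. -/
abbrev quotOrder (B : OrderedBlueprint.{u}) (S : B.carrier → B.carrier → Prop) :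
    PartialOrder (B.genCon S).Quotient where
  le := Quotient.lift₂ (Gen B S) (by
    intro a₁ b₁ a₂ b₂ ha hb
    exact propext ⟨fun h => (Gen.trans ha.2 h).trans hb.1, fun h => (Gen.trans ha.1 h).trans hb.2⟩)
  le_refl := by rintro ⟨x⟩; exact .of_le le_rfl
  le_trans := by rintro ⟨x⟩ ⟨y⟩ ⟨z⟩ h h'; exact Gen.trans h h'
  le_antisymm := by rintro ⟨x⟩ ⟨y⟩ h h'; exact Quotient.sound ⟨h, h'⟩

/-- The quotient `B // ⟨S⟩` of an ordered blueprint by a set `S` of relations `x ≤ y`. -/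
def quot (B : OrderedBlueprint.{u}) (S : B.carrier → B.carrier → Prop) :
    OrderedBlueprint.{u} where
  carrier := (B.genCon S).Quotient
  order := B.quotOrder S
  add_le_add' := by rintro ⟨x⟩ ⟨y⟩ ⟨z⟩ ⟨t⟩ h h'; exact Gen.add h h'
  mul_le_mul' := by rintro ⟨x⟩ ⟨y⟩ ⟨z⟩ ⟨t⟩ h h'; exact Gen.mul h h'
  mon := B.mon.map (B.genCon S).mk'
  zero_mem' := ⟨0, B.zero_mem', map_zero _⟩
  closure_mon := by
    have h := congrArg (Subsemiring.map (B.genCon S).mk') B.closure_mon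
    rw [RingHom.map_closureS] at h
    rw [Submonoid.coe_map]
    refine h.trans (eq_top_iff.2 ?_)
    rintro ⟨x⟩ -
    exact ⟨x, trivial, rfl⟩

/-! ### Subblueprints -/

/-- The ordered subblueprint of `B` that is determined by a submonoid `S` of `B•` containing `0`:
its semiring is the subsemiring of `B⁺` generated by `S`, with the restricted order. -/
def sub (B : OrderedBlueprint.{u}) (S : Submonoid B.carrier) (h0 : (0 : B.carrier) ∈ S) :
    OrderedBlueprint.{u} where
  carrier := Subsemiring.closure (S : Set B.carrier)
  add_le_add' _ _ _ _ h h' := B.add_le_add' _ _ _ _ h h'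
  mul_le_mul' _ _ _ _ h h' := B.mul_le_mul' _ _ _ _ h h'
  mon := S.comap (Subsemiring.closure (S : Set B.carrier)).subtype
  zero_mem' := h0
  closure_mon := by
    refine eq_top_iff.2 ?_
    rintro ⟨x, hx⟩ -
    induction hx using Subsemiring.closure_induction with
    | mem x h => exact Subsemiring.subset_closure h
    | zero => exact zero_mem _
    | one => exact one_mem _
    | add x y _ _ h h' => exact add_mem h h'
    | mul x y _ _ h h' => exact mul_mem h h'

/-! ### Pasteurized ordered blueprints, pastures and foundations -/

/-- Every `a ∈ B` has a unique weak inverse. -/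
def IsPasteurized (B : OrderedBlueprint.{u}) : Prop :=
  ∀ a ∈ B.mon, ∃! b, b ∈ B.mon ∧ 0 ≤ a + b

open Classical in
/-- The weak inverse `ε` of `1` in a pasteurized ordered blueprint (and a junk value if `1` has no
weak inverse). -/
noncomputable def eps (B : OrderedBlueprint.{u}) : B.carrier :=
  if h : ∃ e ∈ B.mon, 0 ≤ 1 + e then h.choose else 0

/-- The monomials `g ∈ H` of `ℕ[G]`, together with `0`. -/
def monomials {G : Type u} [CommGroup G] (H : Subgroup G) : Submonoid (MonoidAlgebra ℕ G) where
  carrier := {x | x = 0 ∨ ∃ g ∈ H, x = MonoidAlgebra.of ℕ G g}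
  one_mem' := Or.inr ⟨1, H.one_mem, (map_one _).symm⟩
  mul_mem' := by
    rintro x y (rfl | ⟨g, hg, rfl⟩) (rfl | ⟨h, hh, rfl⟩)
    · simp
    · simp
    · simp
    · exact Or.inr ⟨g * h, H.mul_mem hg hh, (map_mul _ _ _).symm⟩

/-- The ordered blueprint `(G ∪ {0}, ℕ[G], =)` of the monoid with zero `G ∪ {0}`, where `G` is an
abelian group. -/
noncomputable def ofGroup (G : Type u) [CommGroup G] : OrderedBlueprint.{u} where
  carrier := MonoidAlgebra ℕ G
  order :=
    { le := Eq
      le_refl := fun _ => rfl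
      le_trans := fun _ _ _ => Eq.trans
      le_antisymm := fun _ _ h _ => h }
  add_le_add' := by rintro _ _ _ _ rfl rfl; rfl
  mul_le_mul' := by rintro _ _ _ _ rfl rfl; rfl
  mon := monomials ⊤
  zero_mem' := Or.inl rfl
  closure_mon := by
    refine eq_top_iff.2 fun x _ => ?_
    induction x using MonoidAlgebra.induction_on with
    | of g => exact Subsemiring.subset_closure (Or.inr ⟨g, trivial, rfl⟩)
    | add x y hx hy => exact add_mem (hx trivial) (hy trivial)
    | smul n x hx => exact nsmul_mem (hx trivial) n

/-- The map `ℕ[B^×] → B⁺` that evaluates a formal sum of units of `B`. -/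
noncomputable def evalUnits (B : OrderedBlueprint.{u}) :
    MonoidAlgebra ℕ (B.mon)ˣ →+* B.carrier :=
  (MonoidAlgebra.lift ℕ B.carrier (B.mon)ˣ (B.mon.subtype.comp (Units.coeHom B.mon))).toRingHom

/-- A pasture: a pasteurized ordered blue field with `0 ≠ 1` whose partial order is generated by
relations of the form `0 ≤ ∑ aᵢ`. The last condition concerns the preorder on formal sums of units:
if `∑ aᵢ ≤ ∑ bⱼ` holds in `B`, then this relation is generated, as a preorder on `ℕ[B^×]` that is
closed under addition and multiplication, by the relations `0 ≤ ∑ cₖ` that hold in `B`. -/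
structure IsPasture (B : OrderedBlueprint.{u}) : Prop where
  zero_ne_one : (0 : B.carrier) ≠ 1
  pasteurized : B.IsPasteurized
  blueField : ∀ a ∈ B.mon, a = 0 ∨ B.IsUnitOf a
  purelyPositive : ∀ x y : MonoidAlgebra ℕ (B.mon)ˣ, B.evalUnits x ≤ B.evalUnits y →
    Gen (ofGroup (B.mon)ˣ) (fun s t => s = 0 ∧ 0 ≤ B.evalUnits t) x y

/-- The pasteurization `B^±` of an ordered blueprint `B` over `𝔽₁^±`: the quotient that identifies
all weak inverses of an element. (For general `B` one has to replace `B` by `B ⊗ 𝔽₁^±` first. If `1`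
already has a weak inverse in the image of `𝔽₁^± → B`, then this does not change the result.) -/
def pasteurization (B : OrderedBlueprint.{u}) : OrderedBlueprint.{u} :=
  B.quot fun a a' => a ∈ B.mon ∧ a' ∈ B.mon ∧ ∃ b ∈ B.mon, 0 ≤ a + b ∧ 0 ≤ a' + b

/-- `a` is a fundamental element of `B`: there are `b ∈ B` and `i ∈ {0, 1}` with
`0 ≤ a + b + ε ^ i`. -/
def IsFundamental (B : OrderedBlueprint.{u}) (a : B.carrier) : Prop :=
  a ∈ B.mon ∧ ∃ b ∈ B.mon, ∃ i : Fin 2, 0 ≤ a + b + B.eps ^ (i : ℕ)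

/-- The foundation of `B`: the subblueprint generated by the fundamental elements (`0` is a
fundamental element if `B` is pasteurized). -/
def foundation (B : OrderedBlueprint.{u}) : OrderedBlueprint.{u} :=
  B.sub (Submonoid.closure {a | a = 0 ∨ B.IsFundamental a}) (Submonoid.subset_closure (Or.inl rfl))

end OrderedBlueprint

open OrderedBlueprint

/-! ### Weak matroids with coefficients -/

/-- The `3`-term Plücker expression
`Δ(I₁₂) Δ(I₃₄) + ε Δ(I₁₃) Δ(I₂₄) + Δ(I₁₄) Δ(I₂₃)` where `I_{kl} = I ∪ {i_k, i_l}`. -/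
def pluckerExpr {E : Type v} [DecidableEq E] {R : Type u} [CommSemiring R] (e : R)
    (Δ : Finset E → R) (I : Finset E) (i₁ i₂ i₃ i₄ : E) : R :=
  Δ (I ∪ {i₁, i₂}) * Δ (I ∪ {i₃, i₄}) + e * (Δ (I ∪ {i₁, i₃}) * Δ (I ∪ {i₂, i₄}))
    + Δ (I ∪ {i₁, i₄}) * Δ (I ∪ {i₂, i₃})

/-- The index set of the `3`-term Plücker relations in rank `r`: an `(r - 2)`-subset `I` of `E` and
elements `i₁ < i₂ < i₃ < i₄` that are not in `I`. -/
def IsPluckerIndex {E : Type v} [LinearOrder E] (r : ℕ) (I : Finset E) (i₁ i₂ i₃ i₄ : E) : Prop :=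
  I.card + 2 = r ∧ i₁ < i₂ ∧ i₂ < i₃ ∧ i₃ < i₄ ∧ i₁ ∉ I ∧ i₂ ∉ I ∧ i₃ ∉ I ∧ i₄ ∉ I

/-- The extension by `0` of a function on the `r`-subsets of `E` to all finite subsets. -/
def extendZero {E : Type v} {R : Type u} [Zero R] {r : ℕ} (Δ : {I : Finset E // I.card = r} → R)
    (J : Finset E) : R :=
  if h : J.card = r then Δ ⟨J, h⟩ else 0

/-- A weak Grassmann–Plücker function of rank `r` on `E` with coefficients in `B`. -/
structure WeakGPFunction (B : OrderedBlueprint.{u}) (E : Type v) [LinearOrder E] (r : ℕ) where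
  toFun : {I : Finset E // I.card = r} → B.carrier
  mem_mon : ∀ I, toFun I ∈ B.mon
  /-- The support is the set of bases of a matroid on `E`. -/
  exists_matroid : ∃ M : Matroid E, M.E = Set.univ ∧
    ∀ X : Set E, M.IsBase X ↔ ∃ I, toFun I ≠ 0 ∧ (I.1 : Set E) = X
  plucker : ∀ I i₁ i₂ i₃ i₄, IsPluckerIndex r I i₁ i₂ i₃ i₄ →
    0 ≤ pluckerExpr B.eps (extendZero toFun) I i₁ i₂ i₃ i₄

namespace WeakGPFunction

variable {B : OrderedBlueprint.{u}} {E : Type v} [LinearOrder E] {r : ℕ}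

/-- The matroid whose bases are the support of `Δ`. -/
noncomputable def underlying (Δ : WeakGPFunction B E r) : Matroid E :=
  Δ.exists_matroid.choose

/-- `Δ` and `Δ'` are equivalent if `Δ = a Δ'` for some `a ∈ B^×`. -/
def Equivalent (Δ Δ' : WeakGPFunction B E r) : Prop :=
  ∃ a, B.IsUnitOf a ∧ ∀ I, Δ.toFun I = a * Δ'.toFun I

theorem equivalence_equivalent : Equivalence (Equivalent (B := B) (E := E) (r := r)) where
  refl Δ := ⟨1, ⟨B.mon.one_mem, 1, B.mon.one_mem, one_mul _⟩, fun _ => (one_mul _).symm⟩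
  symm := by
    rintro Δ Δ' ⟨a, ⟨ha, b, hb, hab⟩, h⟩
    exact ⟨b, ⟨hb, a, ha, (mul_comm b a).trans hab⟩, fun I => by
      rw [h, ← mul_assoc, mul_comm b a, hab, one_mul]⟩
  trans := by
    rintro Δ Δ' Δ'' ⟨a, ⟨ha, b, hb, hab⟩, h⟩ ⟨c, ⟨hc, d, hd, hcd⟩, h'⟩
    exact ⟨a * c, ⟨mul_mem ha hc, b * d, mul_mem hb hd, by
      rw [mul_mul_mul_comm, hab, hcd, one_mul]⟩, fun I => by rw [h, h', mul_assoc]⟩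

theorem underlying_congr {Δ Δ' : WeakGPFunction B E r} (h : Equivalent Δ Δ') :
    Δ.underlying = Δ'.underlying := by
  have h₁ := Δ.exists_matroid.choose_spec
  have h₂ := Δ'.exists_matroid.choose_spec
  have key : ∀ I, Δ.toFun I ≠ 0 ↔ Δ'.toFun I ≠ 0 := by
    obtain ⟨a, ⟨-, b, -, hab⟩, h⟩ := h
    refine fun I => not_congr ⟨fun h0 => ?_, fun h0 => by rw [h, h0, mul_zero]⟩
    calc Δ'.toFun I = b * (a * Δ'.toFun I) := by rw [← mul_assoc, mul_comm b a, hab, one_mul]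
      _ = 0 := by rw [← h, h0, mul_zero]
  refine Matroid.ext_isBase (h₁.1.trans h₂.1.symm) fun X _ => ?_
  exact (h₁.2 X).trans (Iff.trans (by simp only [key]) (h₂.2 X).symm)

end WeakGPFunction

/-- The setoid of equivalent weak Grassmann–Plücker functions. -/
def weakGPSetoid (B : OrderedBlueprint.{u}) (E : Type v) [LinearOrder E] (r : ℕ) :
    Setoid (WeakGPFunction B E r) :=
  ⟨WeakGPFunction.Equivalent, WeakGPFunction.equivalence_equivalent⟩

/-- A weak `B`-matroid of rank `r` on `E`: an equivalence class of weak Grassmann–Plücker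
functions. -/
def WeakMatroid (B : OrderedBlueprint.{u}) (E : Type v) [LinearOrder E] (r : ℕ) : Type (max u v) :=
  Quotient (weakGPSetoid B E r)

/-- The underlying matroid of a weak `B`-matroid `[Δ]`, whose bases are the `r`-subsets on which `Δ`
does not vanish. If `B` is a pasture, then this is the pushforward of `[Δ]` along the terminal
morphism from `B` to the Krasner hyperfield. -/
noncomputable def WeakMatroid.underlying {B : OrderedBlueprint.{u}} {E : Type v} [LinearOrder E]
    {r : ℕ} : WeakMatroid B E r → Matroid E :=
  Quotient.lift WeakGPFunction.underlying fun _ _ h => WeakGPFunction.underlying_congr h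

/-- The matroid `M` is weakly representable over `B`. -/
def WeaklyRepresentable {E : Type v} [LinearOrder E] (M : Matroid E) (B : OrderedBlueprint.{u}) :
    Prop :=
  ∃ (r : ℕ) (M' : WeakMatroid B E r), M'.underlying = M

/-! ### The weak universal pasture and the foundation of a matroid -/

section UniversalPasture

variable {E : Type v} [LinearOrder E] (M : Matroid E)

/-- The group of the Laurent monomials `ε^i ∏ x_I^{e_I}` with `i ∈ ℤ/2` and `e_I ∈ ℤ`, where `I`
runs through the bases of `M`. -/
abbrev LaurentMonomials : Type v :=
  Multiplicative (ZMod 2 × ({I : Finset E // M.IsBase (I : Set E)} →₀ ℤ))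

/-- The monomial `ε`. -/
noncomputable def epsVar : MonoidAlgebra ℕ (LaurentMonomials M) :=
  MonoidAlgebra.of ℕ _ (Multiplicative.ofAdd (1, 0))

open Classical in
/-- The monomial `x_I` if `I` is a basis of `M`, and `0` otherwise. -/
noncomputable def basisVar (I : Finset E) : MonoidAlgebra ℕ (LaurentMonomials M) :=
  if h : M.IsBase (I : Set E) then
    MonoidAlgebra.of ℕ _ (Multiplicative.ofAdd (0, Finsupp.single ⟨I, h⟩ 1))
  else 0

/-- The degree `∑ e_I` of the Laurent monomial `ε^i ∏ x_I^{e_I}`. -/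
noncomputable def degree : LaurentMonomials M →* Multiplicative ℤ :=
  AddMonoidHom.toMultiplicative
    ((Finsupp.liftAddHom fun _ => AddMonoidHom.id ℤ).comp (AddMonoidHom.snd _ _))

/-- The relation `0 ≤ 1 + ε` of `𝔽₁^±` and the `3`-term Plücker relations. -/
def PluckerRel (x y : (ofGroup (LaurentMonomials M)).carrier) : Prop :=
  x = 0 ∧ (y = (1 + epsVar M : MonoidAlgebra ℕ (LaurentMonomials M)) ∨
    ∃ (r : ℕ) (I : Finset E) (i₁ i₂ i₃ i₄ : E), M.eRank = r ∧ IsPluckerIndex r I i₁ i₂ i₃ i₄ ∧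
      y = pluckerExpr (epsVar M) (basisVar M) I i₁ i₂ i₃ i₄)

/-- The graded ordered blueprint `𝔽₁^±[x_I^{±1} | I a basis of M] // Pl^w`. -/
noncomputable def pluckerBlueprint : OrderedBlueprint.{v} :=
  (ofGroup (LaurentMonomials M)).quot (PluckerRel M)

/-- The degree-`0` part of `𝔽₁^±[x_I^{±1} | I a basis of M] // Pl^w`: the residue field of the weak
matroid space at the point of `M`. -/
noncomputable def weakResidueField : OrderedBlueprint.{v} :=
  (pluckerBlueprint M).sub
    ((monomials (degree M).ker).map ((ofGroup (LaurentMonomials M)).genCon (PluckerRel M)).mk')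
    ⟨0, Or.inl rfl, map_zero _⟩

/-- The weak universal pasture `k_M^w` of `M`. -/
noncomputable def weakUniversalPasture : OrderedBlueprint.{v} :=
  (weakResidueField M).pasteurization

/-- The foundation `k_M^f` of `M`. -/
noncomputable def matroidFoundation : OrderedBlueprint.{v} :=
  (weakUniversalPasture M).foundation

end UniversalPasture

/-! From 1 to 3: the values of a weak Grassmann–Plücker function on bases are units, so `x_I ↦ Δ(I)`
respects the Plücker relations and defines a morphism on the Plücker blueprint. It restricts to
degree 0, factors through the pasteurization because `F` is pasteurized, and restricts to the
foundation. From 2 to 1, compose with the inclusion of the foundation.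

From 3 to 2: morphisms preserve relations `0 ≤ a + b + ε ^ i`, so `k_M^f → F` lands in the
foundation of `F`. It remains to find a Grassmann–Plücker function with values in `k_M^f`; the `x_I`
themselves do not have degree 0. The torus helps: replacing `x_I` by `x_I / (c ∏_{i ∈ I} w_i)`
multiplies the three terms of each Plücker relation by one common monomial. Suitable `c` and `w`
have to be found.

Let `H` be the group of degree-0 monomials that are, with their inverses, products of fundamental
elements. Dividing a Plücker relation by one of its nonzero terms shows that ratios of two nonzero
terms lie in `H`. Hence the class of `x_I` modulo `H` is a locally modular function on the bases
(`locallyModular_basisClass`). The combinatorial core is `LocallyModular.exists_weight`: such a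
function, with values in any abelian group, has the form `f(B) = c + ∑_{i ∈ B} w_i`. Lifting `c` and
`w` to monomials gives `exists_rescaling`.

To find `w`, fix a basis `B` and think of `B - i + j` as a nonzero entry `(i, j)` of a matrix.
Weights fitting all these neighbours exist if the alternating sums of `f` around closed walks in the
support vanish (`LocallyModular.closed_walk`). Chords cut a walk into shorter ones, and a chordless
walk is shortened by a pivot, that is, by passing to a neighbouring basis. Bases further from `B`
follow by induction on the distance, using the three-term exchange property. -/

/-! ### Potentials of weighted graphs -/

/-- `WeightedWalk S n u v a`: there is a walk of length `n` and total weight `a` from `u` to `v`, where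
`S x y e` says that there is an edge of weight `e` from `x` to `y`. -/
inductive WeightedWalk {V A : Type*} [AddCommGroup A] (S : V → V → A → Prop) :
    ℕ → V → V → A → Prop
  | nil (u) : WeightedWalk S 0 u u 0
  | cons {n u v w a b} : S u v a → WeightedWalk S n v w b → WeightedWalk S (n + 1) u w (a + b)

namespace WeightedWalk

variable {V A : Type*} [AddCommGroup A] {S : V → V → A → Prop}

theorem single {u v : V} {a : A} (h : S u v a) : WeightedWalk S 1 u v a := by
  simpa using cons h (nil v)

theorem append {m n : ℕ} {u v w : V} {a b : A} (h : WeightedWalk S m u v a)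
    (h' : WeightedWalk S n v w b) : WeightedWalk S (m + n) u w (a + b) := by
  induction h with
  | nil u => simpa using h'
  | cons hs _ ih =>
    have := cons hs (ih h')
    rwa [Nat.add_right_comm, ← add_assoc] at this

theorem symm (hS : ∀ u v a, S u v a → S v u (-a)) {n : ℕ} {u v : V} {a : A}
    (h : WeightedWalk S n u v a) : WeightedWalk S n v u (-a) := by
  induction h with
  | nil u => simpa using nil u
  | cons hs _ ih =>
    rw [neg_add_rev]
    exact ih.append (single (hS _ _ _ hs))

theorem mono {S' : V → V → A → Prop} (hS : ∀ u v a, S u v a → S' u v a) {n : ℕ} {u v : V} {a : A}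
    (h : WeightedWalk S n u v a) : WeightedWalk S' n u v a := by
  induction h with
  | nil u => exact nil u
  | cons hs _ ih => exact cons (hS _ _ _ hs) ih

/-- A walk can be split at some vertex other than its end at which `Q` holds, unless `Q` fails at
all vertices other than the end. -/
theorem split (Q : V → Prop) {n : ℕ} {u v : V} {a : A} (h : WeightedWalk S n u v a) (hn : 0 < n) :
    (∃ k l i b c, WeightedWalk S k u i b ∧ WeightedWalk S l i v c ∧ k + l = n ∧ b + c = a ∧ Q i ∧
      0 < l) ∨
    ¬ Q u ∧ ∃ m i b c, m + 1 = n ∧ WeightedWalk (fun x y e => S x y e ∧ ¬ Q x ∧ ¬ Q y) m u i b ∧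
      ¬ Q i ∧ S i v c ∧ b + c = a := by
  induction h with
  | nil u => exact absurd hn (lt_irrefl 0)
  | @cons n u v w a b hs hw ih =>
    by_cases hu : Q u
    · exact Or.inl ⟨0, n + 1, u, 0, a + b, nil u, cons hs hw, zero_add _, zero_add _, hu,
        Nat.succ_pos n⟩
    · rcases Nat.eq_zero_or_pos n with rfl | hn'
      · cases hw
        exact Or.inr ⟨hu, 0, u, 0, a, rfl, nil u, hu, hs, by simp⟩
      · rcases ih hn' with ⟨k, l, i, b', c, h₁, h₂, rfl, rfl, hi, hl⟩ |
          ⟨hv, m, i, b', c, rfl, h₁, hi, h₂, rfl⟩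
        · exact Or.inl ⟨k + 1, l, i, a + b', c, cons hs h₁, h₂, by omega, by abel, hi, hl⟩
        · exact Or.inr ⟨hu, m + 1, i, a + b', c, rfl, cons ⟨hs, hu, hv⟩ h₁, hi, h₂, by abel⟩

/-- A weighted graph has a potential if all its closed walks have weight `0`. -/
theorem exists_potential (hS : ∀ u v a, S u v a → S v u (-a))
    (h0 : ∀ n u a, WeightedWalk S n u u a → a = 0) :
    ∃ w : V → A, ∀ u v a, S u v a → w v = w u + a := by
  -- The potential of a vertex is the weight of a walk from a chosen root of its component; two
  -- choices of walk differ by a closed walk.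
  let s : Setoid V := ⟨fun u v => ∃ n a, WeightedWalk S n u v a, fun u => ⟨0, 0, nil u⟩,
    fun ⟨n, a, h⟩ => ⟨n, -a, h.symm hS⟩, fun ⟨_, _, h⟩ ⟨_, _, h'⟩ => ⟨_, _, h.append h'⟩⟩
  have hr : ∀ u, ∃ a n, WeightedWalk S n (Quotient.mk s u).out u a := fun u => by
    obtain ⟨n, a, h⟩ := Quotient.exact (Quotient.out_eq (Quotient.mk s u))
    exact ⟨a, n, h⟩
  choose w n hw using hr
  refine ⟨w, fun u v a h => ?_⟩
  have huv : Quotient.mk s u = Quotient.mk s v := Quotient.sound ⟨1, a, single h⟩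
  have h₁ := hw u
  rw [huv] at h₁
  have := h0 _ _ _ ((h₁.append (single h)).append ((hw v).symm hS))
  rw [← sub_eq_add_neg, sub_eq_zero] at this
  exact this.symm

end WeightedWalk

/-! ### Modular functions on the bases of a matroid -/

/-- The exchange property of a family of finite sets. -/
def FinsetExchange {E : Type*} [DecidableEq E] (P : Finset E → Prop) : Prop :=
  ∀ B B', P B → P B' → ∀ a ∈ B, a ∉ B' → ∃ b ∈ B', b ∉ B ∧ P (insert b (B.erase a))

/-- The function `f` satisfies all relations `f(Iab) + f(Icd) = f(Iac) + f(Ibd)` between members of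
`P`. -/
def LocallyModular {E A : Type*} [DecidableEq E] [Add A] (P : Finset E → Prop)
    (f : Finset E → A) : Prop :=
  ∀ (I : Finset E) (a b c d : E), a ∉ I → b ∉ I → c ∉ I → d ∉ I →
    a ≠ b → a ≠ c → a ≠ d → b ≠ c → b ≠ d → c ≠ d →
    P (I ∪ {a, b}) → P (I ∪ {c, d}) → P (I ∪ {a, c}) → P (I ∪ {b, d}) →
    f (I ∪ {a, b}) + f (I ∪ {c, d}) = f (I ∪ {a, c}) + f (I ∪ {b, d})

section Modular

variable {E A : Type*} [DecidableEq E] [AddCommGroup A] {P : Finset E → Prop} {f : Finset E → A}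

/-- The element that replaces `a` lies in `I ∪ {c, d}` but not in `I`, so it is `c` or `d`. -/
theorem FinsetExchange.pair (hP : FinsetExchange P) {I : Finset E} {a b c d : E} (ha : a ∉ I)
    (hac : a ≠ c) (had : a ≠ d) (hab : a ≠ b)
    (h₁ : P (I ∪ {a, b})) (h₂ : P (I ∪ {c, d})) : P (I ∪ {b, c}) ∨ P (I ∪ {b, d}) := by
  obtain ⟨y, hy, hy', h⟩ := hP _ _ h₁ h₂ a (by simp) (by simp [ha, hac, had])
  have hI : insert y ((I ∪ {a, b}).erase a) = I ∪ {b, y} := by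
    ext z; simp only [Finset.mem_insert, Finset.mem_erase, Finset.mem_union, Finset.mem_singleton]
    grind
  rw [hI] at h
  simp only [Finset.mem_insert, Finset.mem_union, Finset.mem_singleton] at hy hy'
  rcases hy with hy | rfl | rfl
  · exact absurd (Or.inl hy) hy'
  · exact Or.inl h
  · exact Or.inr h

/-- At least two of the three products in a three-term Plücker relation do not vanish if one of them
does not. -/
theorem FinsetExchange.three_term (hP : FinsetExchange P) {I : Finset E} {a b c d : E} (ha : a ∉ I)
    (hb : b ∉ I) (hc : c ∉ I) (hd : d ∉ I) (hab : a ≠ b) (hac : a ≠ c) (had : a ≠ d) (hbc : b ≠ c)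
    (hbd : b ≠ d) (hcd : c ≠ d) (h₁ : P (I ∪ {a, b})) (h₂ : P (I ∪ {c, d})) :
    P (I ∪ {a, c}) ∧ P (I ∪ {b, d}) ∨ P (I ∪ {a, d}) ∧ P (I ∪ {b, c}) := by
  -- Each of the four elements is exchanged once. If one set of the first alternative is missing,
  -- two of these disjunctions force both sets of the second.
  have e₁ := hP.pair ha hac had hab h₁ h₂
  have e₂ := hP.pair hb hbc hbd hab.symm (by rwa [Finset.pair_comm]) h₂
  have e₃ := hP.pair hc hac.symm hbc.symm hcd h₂ h₁
  have e₄ := hP.pair hd had.symm hbd.symm hcd.symm (by rwa [Finset.pair_comm]) h₁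
  rw [Finset.pair_comm d a, Finset.pair_comm d b] at e₃
  rw [Finset.pair_comm c a, Finset.pair_comm c b] at e₄
  tauto

/-- The set `B - i + j`. -/
def Finset.swap (B : Finset E) (i j : E) : Finset E := insert j (B.erase i)

/-- The setting in which two elements `i, i'` of a basis `B` are exchanged for `j, j'`. -/
theorem Finset.swap_eqs {B : Finset E} {i i' j j' : E} (hi : i ∈ B) (hi' : i' ∈ B) (hj : j ∉ B)
    (hj' : j' ∉ B) (hii : i ≠ i') :
    ∃ I : Finset E, i ∉ I ∧ i' ∉ I ∧ j ∉ I ∧ j' ∉ I ∧ B = I ∪ {i, i'} ∧ B.swap i j = I ∪ {i', j} ∧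
      B.swap i j' = I ∪ {i', j'} ∧ B.swap i' j = I ∪ {i, j} ∧ B.swap i' j' = I ∪ {i, j'} ∧
      (B.swap i' j').swap i j = I ∪ {j, j'} := by
  refine ⟨(B.erase i).erase i', by simp, by simp, by simp [hj], by simp [hj'], ?_⟩
  refine ⟨?_, ?_, ?_, ?_, ?_, ?_⟩ <;> ext z <;>
    simp only [Finset.swap, Finset.mem_insert, Finset.mem_erase, Finset.mem_union,
      Finset.mem_singleton] <;> grind

/-- For `i ≠ i'` and `j ≠ j'` this is the modular relation over `I = B \ {i, i'}`. It makes the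
weight of an exchange step independent of `j`; `B` itself need not satisfy `P`. -/
theorem LocallyModular.square (hf : LocallyModular P f) {B : Finset E} {i i' j j' : E}
    (hi : i ∈ B) (hi' : i' ∈ B) (hj : j ∉ B) (hj' : j' ∉ B) (h₁ : P (B.swap i j))
    (h₂ : P (B.swap i j')) (h₃ : P (B.swap i' j)) (h₄ : P (B.swap i' j')) :
    f (B.swap i j) - f (B.swap i' j) = f (B.swap i j') - f (B.swap i' j') := by
  by_cases hii : i = i'
  · simp [hii]
  by_cases hjj : j = j'
  · simp [hjj]
  obtain ⟨I, hiI, hiI', hjI, hjI', e₀, e₁, e₂, e₃, e₄, e₅⟩ := Finset.swap_eqs hi hi' hj hj' hii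
  rw [e₁] at h₁ ⊢; rw [e₂] at h₂ ⊢; rw [e₃] at h₃ ⊢; rw [e₄] at h₄ ⊢
  have := hf I i' j j' i hiI' hjI hjI' hiI (by grind) (by grind) (by grind) (by grind) (by grind)
    (by grind) h₁ (by rwa [Finset.pair_comm]) h₂ (by rwa [Finset.pair_comm])
  rw [Finset.pair_comm j' i, Finset.pair_comm j i] at this
  rw [sub_eq_sub_iff_add_eq_add, this]

/-- A pivot in `(i', j')` does not change an entry in a row or a column in which the pivot column or
the pivot row vanishes. -/
theorem LocallyModular.pivot_of_not (hP : FinsetExchange P) (hf : LocallyModular P f) {B : Finset E}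
    {i i' j j' : E} (hi : i ∈ B) (hi' : i' ∈ B) (hj : j ∉ B) (hj' : j' ∉ B) (hii : i ≠ i')
    (hjj : j ≠ j') (h₀ : P B) (h₁ : P (B.swap i' j')) (h₂ : P (B.swap i j))
    (h₃ : ¬ (P (B.swap i j') ∧ P (B.swap i' j))) :
    P ((B.swap i' j').swap i j) ∧
      f ((B.swap i' j').swap i j) = f (B.swap i' j') + f (B.swap i j) - f B := by
  obtain ⟨I, hiI, hiI', hjI, hjI', e₀, e₁, e₂, e₃, e₄, e₅⟩ := Finset.swap_eqs hi hi' hj hj' hii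
  rw [e₁] at h₂; rw [e₂, e₃] at h₃; rw [e₄] at h₁
  rw [e₁, e₅, e₄]
  have hB : f B = f (I ∪ {i, i'}) := congrArg f e₀
  rw [e₀] at h₀; rw [hB]
  -- The products `{i, j'}{i', j}`, `{i, i'}{j, j'}` and `{i, j}{i', j'}` form a three-term
  -- relation. The first is nonzero and `h₃` kills the last, so the middle one is nonzero.
  have key : P (I ∪ {j, j'}) := by
    have := hP.three_term (a := i) (b := j') (c := i') (d := j) hiI hjI' hiI' hjI (by grind)
      (by grind) (by grind) (by grind) (by grind) (by grind) h₁ h₂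
    rw [Finset.pair_comm j' j, Finset.pair_comm j' i'] at this
    tauto
  refine ⟨key, ?_⟩
  have := hf I i j' i' j hiI hjI' hiI' hjI (by grind)
      (by grind) (by grind) (by grind) (by grind) (by grind) h₁ h₂ h₀ (by rwa [Finset.pair_comm])
  rw [this, Finset.pair_comm j' j]; abel

/-- A pivot in `(i', j')` makes a vanishing entry `(i, j)` nonzero if the entries `(i, j')` and
`(i', j)` are nonzero. -/
theorem LocallyModular.pivot_cross (hP : FinsetExchange P) (hf : LocallyModular P f) {B : Finset E}
    {i i' j j' : E} (hi : i ∈ B) (hi' : i' ∈ B) (hj : j ∉ B) (hj' : j' ∉ B) (hii : i ≠ i')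
    (hjj : j ≠ j') (h₀ : P B) (h₁ : P (B.swap i j')) (h₂ : P (B.swap i' j))
    (h₃ : ¬ P (B.swap i j)) :
    P ((B.swap i' j').swap i j) ∧
      f ((B.swap i' j').swap i j) = f (B.swap i j') + f (B.swap i' j) - f B := by
  obtain ⟨I, hiI, hiI', hjI, hjI', e₀, e₁, e₂, e₃, e₄, e₅⟩ := Finset.swap_eqs hi hi' hj hj' hii
  rw [e₁] at h₃; rw [e₂] at h₁; rw [e₃] at h₂
  rw [e₂, e₅, e₃]
  have hB : f B = f (I ∪ {i, i'}) := congrArg f e₀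
  rw [e₀] at h₀; rw [hB]
  rw [Finset.pair_comm] at h₁
  have key : P (I ∪ {j, j'}) := by
    have := hP.three_term (a := i) (b := j) (c := i') (d := j') hiI hjI hiI' hjI' (by grind)
      (by grind) (by grind) (by grind) (by grind) (by grind) h₂ (by rwa [Finset.pair_comm])
    rw [Finset.pair_comm j i'] at this
    tauto
  refine ⟨key, ?_⟩
  have := hf I i j i' j' hiI hjI hiI' hjI' (by grind)
      (by grind) (by grind) (by grind) (by grind) (by grind) h₂ (by rwa [Finset.pair_comm]) h₀ key
  rw [add_comm (f (I ∪ {i', j'})), this]; abel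

/-! ### Closed walks in the exchange graph of a basis -/

/-- `i` and `i'` are elements of `B` that are both exchangeable for some `j`; the weight is the
difference of the values of `f` at the two resulting bases. -/
def ExchangeStep (P : Finset E → Prop) (f : Finset E → A) (B : Finset E) (i i' : E) (a : A) : Prop :=
  ∃ j, j ∉ B ∧ i ∈ B ∧ i' ∈ B ∧ P (B.swap i j) ∧ P (B.swap i' j) ∧
    f (B.swap i j) - f (B.swap i' j) = a

theorem ExchangeStep.symm {B : Finset E} {i i' : E} {a : A} (h : ExchangeStep P f B i i' a) :
    ExchangeStep P f B i' i (-a) := by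
  obtain ⟨j, hj, hi, hi', h₁, h₂, rfl⟩ := h
  exact ⟨j, hj, hi', hi, h₂, h₁, by abel⟩

theorem LocallyModular.step_unique (hf : LocallyModular P f) {B : Finset E} {i i' : E} {a b : A}
    (h : ExchangeStep P f B i i' a) (h' : ExchangeStep P f B i i' b) : a = b := by
  obtain ⟨j, hj, hi, hi', h₁, h₂, rfl⟩ := h
  obtain ⟨j', hj', -, -, h₁', h₂', rfl⟩ := h'
  exact hf.square hi hi' hj hj' h₁ h₁' h₂ h₂'

/-- Strong induction on the length, for all bases simultaneously. A walk `i₁, i₂, i₃, …, i, i₁`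
whose first two steps go through `j₁`, `j₂` and whose last goes through `j` is cut or shortened if
`j₁`, `j₂` or `j` provides a chord. Otherwise a pivot in `(i₂, j₁)` removes `i₂`: in the new basis
`i₁` and `i₃` are joined through `j₂`, and the total weight is unchanged. -/
theorem LocallyModular.closed_walk (hP : FinsetExchange P) (hf : LocallyModular P f) (n : ℕ) :
    ∀ (B : Finset E), P B → ∀ (i : E) (a : A), WeightedWalk (ExchangeStep P f B) n i i a → a = 0 := by
  induction n using Nat.strong_induction_on with
  | _ n ih =>
  intro B hB i₁ a h
  cases h with
  | nil => rfl
  | @cons n _ i₂ _ a₁ b h₁ h =>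
  cases h with
  | nil =>
    obtain ⟨j, -, -, -, -, -, rfl⟩ := h₁
    simp
  | @cons n _ i₃ _ a₂ a₃ h₂ h =>
  rcases Nat.eq_zero_or_pos n with rfl | hn
  · cases h
    rw [hf.step_unique h₁ h₂.symm]
    abel
  have h₁' := h₁
  have h₂' := h₂
  obtain ⟨j₁, hj₁, hi₁, hi₂, p₁, q₁, rfl⟩ := h₁
  obtain ⟨j₂, hj₂, -, hi₃, p₂, q₂, rfl⟩ := h₂
  -- A later vertex `i`, before the end, that is adjacent to `j₁` splits the walk into a closed walk
  -- at `i₂` and one at `i₁`, both shorter.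
  rcases h.split (fun i => i ∈ B ∧ P (B.swap i j₁)) hn with
    ⟨k, l, i, b, c, w₁, w₂, rfl, rfl, ⟨hi, hiP⟩, hl⟩ | ⟨hQ₃, m, i, b, c, rfl, w, hQi, hs, rfl⟩
  · have e₁ := ih (k + 1 + 1) (by omega) B hB i₂ _
      ((WeightedWalk.cons h₂' w₁).append (.single ⟨j₁, hj₁, hi, hi₂, hiP, q₁, rfl⟩))
    have e₂ := ih (l + 1) (by omega) B hB i₁ _
      (WeightedWalk.cons ⟨j₁, hj₁, hi₁, hi, p₁, hiP, rfl⟩ w₂)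
    rw [← add_zero (0 : A)]
    nth_rw 1 [← e₁]
    rw [← e₂]
    abel
  -- If `i₁` is adjacent to `j₂`, then `i₂` can be skipped at the start of the walk.
  by_cases hC : P (B.swap i₁ j₂)
  · have e₁ := ih (m + 1 + 1) (by omega) B hB i₁ _
      (WeightedWalk.cons ⟨j₂, hj₂, hi₁, hi₃, hC, q₂, rfl⟩ h)
    have e₂ := hf.step_unique h₁' ⟨j₂, hj₂, hi₁, hi₂, hC, p₂, rfl⟩
    rw [e₂, ← e₁]
    abel
  have hs' := hs
  obtain ⟨j, hj, hi, -, p, q, rfl⟩ := hs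
  have w' := w.mono (fun u v a (h : _ ∧ _) => h.1)
  -- If `i₂` is adjacent to `j`, the walk can close at `i₂` and skip `i₁`.
  by_cases hD : P (B.swap i₂ j)
  · have e₁ := ih (m + 1 + 1) (by omega) B hB i₂ _
      ((WeightedWalk.cons h₂' w').append (.single ⟨j, hj, hi, hi₂, p, hD, rfl⟩))
    have e₂ := hf.step_unique h₁' ⟨j, hj, hi₁, hi₂, q, hD, rfl⟩
    rw [e₂, ← e₁]
    abel
  -- No chords are left: pivot in `(i₂, j₁)`. The entries used between `i₃` and `i` shift by the
  -- constant `f (B.swap i₂ j₁) - f B`, as their rows vanish in column `j₁`; so does `(i₁, j)`, as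
  -- row `i₂` vanishes in column `j`. The zero entry `(i₁, j₂)` becomes nonzero.
  have hj₂₁ : j₂ ≠ j₁ := by rintro rfl; exact hC p₁
  have hjj₁ : j ≠ j₁ := by rintro rfl; exact hQi ⟨hi, p⟩
  have hi₁₂ : i₁ ≠ i₂ := by rintro rfl; exact hD q
  have hne : ∀ x, ¬ (x ∈ B ∧ P (B.swap x j₁)) → x ≠ i₂ := by
    rintro _ h rfl; exact h ⟨hi₂, q₁⟩
  have hmem : ∀ x ∈ B, x ≠ i₂ → x ∈ B.swap i₂ j₁ := fun x hx hx' => by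
    simp [Finset.swap, hx, hx']
  have hnmem : ∀ x, x ∉ B → x ≠ j₁ → x ∉ B.swap i₂ j₁ := fun x hx hx' => by
    simp [Finset.swap, hx, hx']
  have hQ : ∀ x ∈ B, ¬ (x ∈ B ∧ P (B.swap x j₁)) → ∀ y, y ∉ B → y ≠ j₁ → P (B.swap x y) →
      P ((B.swap i₂ j₁).swap x y) ∧
      f ((B.swap i₂ j₁).swap x y) = f (B.swap i₂ j₁) + f (B.swap x y) - f B :=
    fun x hx hxQ y hy hy' hxy => hf.pivot_of_not hP hx hi₂ hy hj₁ (hne x hxQ) hy' hB q₁ hxy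
      (fun h => hxQ ⟨hx, h.1⟩)
  have w₁ : WeightedWalk (ExchangeStep P f (B.swap i₂ j₁)) m i₃ i b := by
    refine w.mono ?_
    rintro x y _ ⟨⟨l, hl, hx, hy, p', q', rfl⟩, hxQ, hyQ⟩
    have hlj : l ≠ j₁ := by rintro rfl; exact hxQ ⟨hx, p'⟩
    have t₁ := hQ x hx hxQ l hl hlj p'
    have t₂ := hQ y hy hyQ l hl hlj q'
    exact ⟨l, hnmem l hl hlj, hmem x hx (hne x hxQ), hmem y hy (hne y hyQ), t₁.1, t₂.1, by
      rw [t₁.2, t₂.2]; abel⟩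
  have t₁ := hf.pivot_cross hP hi₁ hi₂ hj₂ hj₁ hi₁₂ hj₂₁ hB p₁ p₂ hC
  have t₂ := hQ i₃ hi₃ hQ₃ j₂ hj₂ hj₂₁ q₂
  have t₃ := hQ i hi hQi j hj hjj₁ p
  have t₄ := hf.pivot_of_not hP hi₁ hi₂ hj hj₁ hi₁₂ hjj₁ hB q₁ q (fun h => hD h.2)
  have e := ih (m + 1 + 1) (by omega) _ q₁ i₁ _ ((WeightedWalk.cons
    ⟨j₂, hnmem _ hj₂ hj₂₁, hmem _ hi₁ hi₁₂, hmem _ hi₃ (hne _ hQ₃), t₁.1, t₂.1, rfl⟩ w₁).append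
    (.single ⟨j, hnmem _ hj hjj₁, hmem _ hi (hne _ hQi), hmem _ hi₁ hi₁₂, t₃.1, t₄.1, rfl⟩))
  rw [t₁.2, t₂.2, t₃.2, t₄.2] at e
  rw [← e]
  abel

/-- A locally modular function is affine on a basis and its neighbours. -/
theorem LocallyModular.exists_weight_swap (hP : FinsetExchange P) (hf : LocallyModular P f)
    {B : Finset E} (hB : P B) :
    ∃ w : E → A, ∀ i ∈ B, ∀ j, j ∉ B → P (B.swap i j) → f (B.swap i j) = f B - w i + w j := by
  obtain ⟨w, hw⟩ := WeightedWalk.exists_potential (S := ExchangeStep P f B)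
    (fun _ _ _ h => h.symm) (fun n i a h => hf.closed_walk hP n B hB i a h)
  -- By the choice of the potential, `w i + f (B.swap i j)` does not depend on `i`, which determines
  -- the weight of `j`.
  have hj : ∀ j, ∃ x, ∀ i ∈ B, j ∉ B → P (B.swap i j) → f (B.swap i j) = f B - w i + x := by
    intro j
    by_cases h : ∃ i ∈ B, j ∉ B ∧ P (B.swap i j)
    · obtain ⟨i, hi, hj, h⟩ := h
      refine ⟨f (B.swap i j) - f B + w i, fun i' hi' _ h' => ?_⟩
      rw [hw i' i _ ⟨j, hj, hi', hi, h', h, rfl⟩]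
      abel
    · push Not at h
      exact ⟨0, fun i hi hj hP => absurd hP (h i hi hj)⟩
  choose x hx using hj
  classical
  refine ⟨fun e => if e ∈ B then w e else x e, fun i hi j hj h => ?_⟩
  simp only [if_pos hi, if_neg hj]
  exact hx j i hi hj h

/-- A locally modular function on the bases of a matroid is affine. -/
theorem LocallyModular.exists_weight (hP : FinsetExchange P) (hf : LocallyModular P f) :
    ∃ (c : A) (w : E → A), ∀ B, P B → f B = c + ∑ i ∈ B, w i := by
  by_cases h : ∃ B, P B
  swap
  · exact ⟨0, 0, fun B hB => absurd ⟨B, hB⟩ h⟩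
  obtain ⟨B₀, hB₀⟩ := h
  obtain ⟨w, hw⟩ := hf.exists_weight_swap hP hB₀
  refine ⟨f B₀ - ∑ i ∈ B₀, w i, w, fun B hB => ?_⟩
  -- Induction on the distance from `B₀`; distances 0 and 1 are the choice of the constant and of
  -- `w`.
  have key : ∀ n (B : Finset E), (B \ B₀).card = n → P B →
      f B = f B₀ - ∑ i ∈ B₀, w i + ∑ i ∈ B, w i := by
    intro n
    induction n using Nat.strong_induction_on with
    | _ n ih =>
    intro B hn hB
    have hsub : ∀ B, P B → B ⊆ B₀ → B = B₀ := fun B hB h => by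
      by_contra hne
      obtain ⟨x, hx, hx'⟩ := Finset.exists_of_ssubset (h.ssubset_of_ne hne)
      obtain ⟨y, hy, hy', -⟩ := hP _ _ hB₀ hB x hx hx'
      exact hy' (h hy)
    by_cases h0 : B ⊆ B₀
    · rw [hsub B hB h0]; abel
    obtain ⟨j₁, hj₁, hj₁'⟩ := Finset.not_subset.1 h0
    obtain ⟨i₁, hi₁, hi₁', hB₁⟩ := hP _ _ hB hB₀ j₁ hj₁ hj₁'
    by_cases h1 : insert i₁ (B.erase j₁) ⊆ B₀
    · have e := hsub _ hB₁ h1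
      have e' : B = B₀.swap i₁ j₁ := by
        ext z; rw [← e]
        simp only [Finset.swap, Finset.mem_insert, Finset.mem_erase]; grind
      rw [e'] at hB
      rw [e', hw i₁ hi₁ j₁ hj₁' hB, Finset.swap, Finset.sum_insert (by simp [hj₁']),
        ← Finset.add_sum_erase _ _ hi₁]
      abel
    obtain ⟨j₂, hj₂, hj₂'⟩ := Finset.not_subset.1 h1
    obtain ⟨i₂, hi₂, hi₂', hB₂⟩ := hP _ _ hB₁ hB₀ j₂ hj₂ hj₂'
    have hj₂i : j₂ ≠ i₁ := by rintro rfl; exact hj₂' hi₁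
    have hj₂B : j₂ ∈ B := by simp [hj₂i] at hj₂; exact hj₂.2
    have hj₁₂ : j₂ ≠ j₁ := by simp [hj₂i] at hj₂; exact hj₂.1
    have hi₂₁ : i₂ ≠ i₁ := by rintro rfl; simp at hi₂'
    have hi₂j : i₂ ≠ j₁ := by rintro rfl; exact hj₁' hi₂
    have hi₂B : i₂ ∉ B := fun h => hi₂' (by simp [h, hi₂j])
    -- At distance at least 2, two exchanges towards `B₀` replace `j₁, j₂` by `i₁, i₂`. In either
    -- case of the three-term property the other three bases of a modular relation are closer to
    -- `B₀`, and affine functions satisfy that relation.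
    obtain ⟨I, hI⟩ : ∃ I, I = (B.erase j₁).erase j₂ := ⟨_, rfl⟩
    have n₁ : j₁ ∉ I := by simp [hI]
    have n₂ : j₂ ∉ I := by simp [hI]
    have n₃ : i₁ ∉ I := by simp [hI, hi₁']
    have n₄ : i₂ ∉ I := by simp [hI, hi₂B]
    have e₀ : B = I ∪ {j₁, j₂} := by
      ext z; simp only [hI, Finset.mem_erase, Finset.mem_union, Finset.mem_insert,
        Finset.mem_singleton]; grind
    have e₂ : insert i₂ ((insert i₁ (B.erase j₁)).erase j₂) = I ∪ {i₁, i₂} := by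
      ext z; simp only [hI, Finset.mem_erase, Finset.mem_union, Finset.mem_insert,
        Finset.mem_singleton]; grind
    rw [e₂] at hB₂
    have hsd : ∀ x y, x ∉ I → y ∉ I → x ≠ y →
        ((I ∪ {x, y}) \ B₀).card = (I \ B₀).card + (if x ∈ B₀ then 0 else 1) +
          (if y ∈ B₀ then 0 else 1) := by
      intro x y hx hy hxy
      rw [Finset.union_sdiff_distrib, Finset.card_union_of_disjoint, add_assoc]
      · congr 1
        by_cases h₁ : x ∈ B₀ <;> by_cases h₂ : y ∈ B₀ <;>
          simp [Finset.sdiff_eq_filter, Finset.filter_insert, Finset.filter_singleton, h₁, h₂, hxy]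
      · refine Finset.disjoint_of_subset_left Finset.sdiff_subset
          (Finset.disjoint_of_subset_right Finset.sdiff_subset ?_)
        simp [hx, hy]
    have hsum : ∀ x y, x ∉ I → y ∉ I → x ≠ y →
        ∑ i ∈ I ∪ {x, y}, w i = ∑ i ∈ I, w i + (w x + w y) := by
      intro x y hx hy hxy
      rw [Finset.sum_union (by simp [hx, hy]), Finset.sum_pair hxy]
    have hjj := hsd j₁ j₂ n₁ n₂ hj₁₂.symm
    rw [← e₀, hn, if_neg hj₁', if_neg hj₂'] at hjj
    have hii := ih _ (by rw [hsd i₁ i₂ n₃ n₄ hi₂₁.symm, if_pos hi₁, if_pos hi₂]; omega) _ rfl hB₂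
    have hji : ∀ x y, x ∉ I → y ∉ I → x ≠ y → x ∉ B₀ → y ∈ B₀ → P (I ∪ {x, y}) →
        f (I ∪ {x, y}) = f B₀ - ∑ i ∈ B₀, w i + ∑ i ∈ I ∪ {x, y}, w i := by
      intro x y hx hy hxy hx' hy' h
      exact ih _ (by rw [hsd x y hx hy hxy, if_neg hx', if_pos hy']; omega) _ rfl h
    have d₁ : j₁ ≠ i₁ := by rintro rfl; exact hj₁' hi₁
    have d₂ : j₂ ≠ i₂ := by rintro rfl; exact hj₂' hi₂
    rw [e₀] at hB ⊢
    rw [hsum _ _ n₁ n₂ hj₁₂.symm]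
    rw [hsum _ _ n₃ n₄ hi₂₁.symm] at hii
    rcases hP.three_term n₁ n₂ n₃ n₄ hj₁₂.symm d₁ hi₂j.symm hj₂i d₂ hi₂₁.symm hB hB₂ with
      ⟨r₁, r₂⟩ | ⟨r₁, r₂⟩
    · have e := hf I j₁ j₂ i₁ i₂ n₁ n₂ n₃ n₄ hj₁₂.symm d₁ hi₂j.symm hj₂i d₂ hi₂₁.symm hB hB₂ r₁ r₂
      rw [hji _ _ n₁ n₃ d₁ hj₁' hi₁ r₁, hji _ _ n₂ n₄ d₂ hj₂' hi₂ r₂, hsum _ _ n₁ n₃ d₁,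
        hsum _ _ n₂ n₄ d₂, hii, ← eq_sub_iff_add_eq] at e
      rw [e]; abel
    · have e := hf I j₁ j₂ i₂ i₁ n₁ n₂ n₄ n₃ hj₁₂.symm hi₂j.symm d₁ d₂ hj₂i hi₂₁ hB
        (by rwa [Finset.pair_comm]) r₁ r₂
      rw [Finset.pair_comm i₂ i₁] at e
      rw [hji _ _ n₁ n₄ hi₂j.symm hj₁' hi₂ r₁, hji _ _ n₂ n₃ hj₂i hj₂' hi₁ r₂,
        hsum _ _ n₁ n₄ hi₂j.symm, hsum _ _ n₂ n₃ hj₂i, hii, ← eq_sub_iff_add_eq] at e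
      rw [e]; abel
  exact key _ B rfl hB

end Modular

/-! ### Morphisms of ordered blueprints -/

namespace OrderedBlueprint

variable {B : OrderedBlueprint.{u}} {C : OrderedBlueprint.{v}}

theorem Hom.le_of_gen (f : Hom B C) {S : B.carrier → B.carrier → Prop}
    (hS : ∀ x y, S x y → f.toRingHom x ≤ f.toRingHom y) {x y : B.carrier} (h : Gen B S x y) :
    f.toRingHom x ≤ f.toRingHom y := by
  induction h with
  | of_le h => exact f.map_le _ _ h
  | of_rel h => exact hS _ _ h
  | trans _ _ h h' => exact h.trans h'
  | add _ _ h h' => rw [map_add, map_add]; exact C.add_le_add' _ _ _ _ h h'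
  | mul _ _ h h' => rw [map_mul, map_mul]; exact C.mul_le_mul' _ _ _ _ h h'

/-- The universal property of the quotient `B // ⟨S⟩`. -/
def Hom.quotLift (f : Hom B C) (S : B.carrier → B.carrier → Prop)
    (hS : ∀ x y, S x y → f.toRingHom x ≤ f.toRingHom y) : Hom (B.quot S) C where
  toRingHom := (B.genCon S).lift f.toRingHom fun _ _ h =>
    le_antisymm (f.le_of_gen hS h.1) (f.le_of_gen hS h.2)
  map_le := by rintro ⟨x⟩ ⟨y⟩ h; exact f.le_of_gen hS h
  map_mon := by rintro _ ⟨a, ha, rfl⟩; exact f.map_mon a ha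

/-- The composition of morphisms. -/
def Hom.comp {D : OrderedBlueprint.{u}} (g : Hom B C) (f : Hom D B) : Hom D C where
  toRingHom := g.toRingHom.comp f.toRingHom
  map_le _ _ h := g.map_le _ _ (f.map_le _ _ h)
  map_mon a ha := g.map_mon _ (f.map_mon a ha)

/-- The inclusion of a subblueprint. -/
def subIncl (B : OrderedBlueprint.{u}) (S : Submonoid B.carrier) (h0 : (0 : B.carrier) ∈ S)
    (hS : S ≤ B.mon) : Hom (B.sub S h0) B where
  toRingHom := (Subsemiring.closure (S : Set B.carrier)).subtype
  map_le _ _ h := h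
  map_mon _ h := hS h

/-- The submonoid that is generated by `0` and the fundamental elements. -/
abbrev fundamentalMonoid (B : OrderedBlueprint.{u}) : Submonoid B.carrier :=
  Submonoid.closure {a | a = 0 ∨ B.IsFundamental a}

theorem fundamentalMonoid_le (B : OrderedBlueprint.{u}) : B.fundamentalMonoid ≤ B.mon := by
  refine Submonoid.closure_le.2 ?_
  rintro a (rfl | h)
  · exact B.zero_mem'
  · exact h.1

/-- The inclusion of the foundation. -/
def foundationIncl (B : OrderedBlueprint.{u}) : Hom B.foundation B :=
  B.subIncl _ _ B.fundamentalMonoid_le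

theorem foundationIncl_injective (B : OrderedBlueprint.{u}) :
    Function.Injective B.foundationIncl.toRingHom := Subtype.val_injective

theorem eps_spec (h : ∃ e ∈ B.mon, 0 ≤ 1 + e) : B.eps ∈ B.mon ∧ 0 ≤ 1 + B.eps := by
  rw [eps, dif_pos h]; exact h.choose_spec

theorem IsPasteurized.exists_eps (h : B.IsPasteurized) : ∃ e ∈ B.mon, 0 ≤ 1 + e :=
  (h 1 B.mon.one_mem).exists

theorem IsPasteurized.eq_eps (h : B.IsPasteurized) {e : B.carrier} (he : e ∈ B.mon)
    (h' : 0 ≤ 1 + e) : e = B.eps :=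
  (h 1 B.mon.one_mem).unique ⟨he, h'⟩ (eps_spec h.exists_eps)

/-- Multiplying `0 ≤ 1 + ε` by `ε` shows that `ε * ε` and `1` are both weak inverses of `ε`. -/
theorem IsPasteurized.eps_mul_eps (h : B.IsPasteurized) : B.eps * B.eps = 1 := by
  have he := eps_spec h.exists_eps
  refine (h _ he.1).unique ⟨mul_mem he.1 he.1, ?_⟩ ⟨B.mon.one_mem, by rw [add_comm]; exact he.2⟩
  have := B.mul_le_mul' _ _ _ _ (le_refl B.eps) he.2
  rwa [mul_zero, mul_add, mul_one] at this

theorem isFundamental_of_nonneg {a b : B.carrier} (ha : a ∈ B.mon) (hb : b ∈ B.mon)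
    (h : 0 ≤ a + b + 1) : B.IsFundamental a :=
  ⟨ha, b, hb, 0, by simpa using h⟩

theorem isFundamental_of_nonneg_one_add {e : B.carrier} (he : e ∈ B.mon) (h : 0 ≤ 1 + e) :
    B.IsFundamental e :=
  isFundamental_of_nonneg he B.zero_mem' (by rwa [add_zero, add_comm])

theorem mem_foundation_of_isFundamental {a : B.carrier} (h : B.IsFundamental a) :
    a ∈ B.fundamentalMonoid :=
  Submonoid.subset_closure (Or.inr h)

/-- The element of the foundation that is given by a product of fundamental elements. -/
def toFoundation (B : OrderedBlueprint.{u}) (a : B.carrier) (ha : a ∈ B.fundamentalMonoid) :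
    B.foundation.carrier :=
  ⟨a, Subsemiring.subset_closure ha⟩

theorem toFoundation_mem (a : B.carrier) (ha : a ∈ B.fundamentalMonoid) :
    B.toFoundation a ha ∈ B.foundation.mon := ha

theorem exists_eps_foundation (h : ∃ e ∈ B.mon, 0 ≤ 1 + e) :
    ∃ e ∈ B.foundation.mon, 0 ≤ 1 + e := by
  obtain ⟨e, he, he'⟩ := h
  exact ⟨B.toFoundation e (mem_foundation_of_isFundamental (isFundamental_of_nonneg_one_add he he')),
    toFoundation_mem _ _, he'⟩

/-- The two values of `eps` are separate choices; they agree by uniqueness in `B`. -/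
theorem IsPasteurized.foundationIncl_eps (h : B.IsPasteurized) :
    B.foundationIncl.toRingHom B.foundation.eps = B.eps := by
  have he := eps_spec (exists_eps_foundation h.exists_eps)
  exact h.eq_eps (B.foundationIncl.map_mon _ he.1) he.2

/-- In a pasteurized ordered blueprint and its foundation, the weak inverse of `1` is unique. -/
theorem IsPasteurized.eq_eps_foundation (h : B.IsPasteurized) {e : B.foundation.carrier}
    (he : e ∈ B.foundation.mon) (h' : 0 ≤ 1 + e) : e = B.foundation.eps :=
  B.foundationIncl_injective <| (h.eq_eps (B.foundationIncl.map_mon _ he) h').trans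
    h.foundationIncl_eps.symm

/-- A morphism maps fundamental elements to fundamental elements. -/
theorem Hom.map_fundamentalMonoid (hB : ∃ e ∈ B.mon, 0 ≤ 1 + e) (hC : C.IsPasteurized)
    (f : Hom B.foundation C) {a : B.carrier} (ha : a ∈ B.fundamentalMonoid) :
    f.toRingHom (B.toFoundation a ha) ∈ C.fundamentalMonoid := by
  have heB := eps_spec hB
  have hfe := isFundamental_of_nonneg_one_add heB.1 heB.2
  have he : f.toRingHom (B.toFoundation B.eps (mem_foundation_of_isFundamental hfe)) = C.eps := by
    refine hC.eq_eps (f.map_mon _ (toFoundation_mem _ _)) ?_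
    rw [← map_zero f.toRingHom, ← map_one f.toRingHom, ← map_add]
    exact f.map_le _ _ heB.2
  induction ha using Submonoid.closure_induction with
  | mem x h =>
    rcases h with rfl | h
    · refine Submonoid.subset_closure (Or.inl ?_)
      exact map_zero f.toRingHom
    · have h' := h
      obtain ⟨hx, b, hb, i, hi⟩ := h'
      -- The relation is symmetric in its two elements, so it already holds inside the foundation,
      -- where `f` can be applied.
      have hbf : B.IsFundamental b := ⟨hb, x, hx, i, by rwa [add_comm b]⟩
      refine mem_foundation_of_isFundamental ⟨f.map_mon _ (toFoundation_mem _ _),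
        _, f.map_mon _ (toFoundation_mem b (mem_foundation_of_isFundamental hbf)), i, ?_⟩
      rw [← he, ← map_zero f.toRingHom, ← map_pow, ← map_add, ← map_add]
      exact f.map_le _ _ hi
  | one => exact (map_one f.toRingHom).symm ▸ one_mem _
  | mul x y hx hy h h' =>
    have := mul_mem h h'
    rw [← map_mul] at this
    exact this

/-- A morphism from a foundation to a pasteurized ordered blueprint has values in the foundation. -/
theorem Hom.nonempty_foundation (hB : ∃ e ∈ B.mon, 0 ≤ 1 + e) (hC : C.IsPasteurized)
    (f : Hom B.foundation C) : Nonempty (Hom B.foundation C.foundation) := by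
  have hmem : ∀ x, f.toRingHom x ∈ Subsemiring.closure (C.fundamentalMonoid : Set C.carrier) := by
    have : Subsemiring.closure (B.foundation.mon : Set B.foundation.carrier) ≤
        (Subsemiring.closure (C.fundamentalMonoid : Set C.carrier)).comap f.toRingHom :=
      Subsemiring.closure_le.2 fun x hx =>
        Subsemiring.subset_closure (f.map_fundamentalMonoid hB hC hx)
    rw [B.foundation.closure_mon] at this
    exact fun x => this trivial
  exact ⟨{
    toRingHom := f.toRingHom.codRestrict _ hmem
    map_le := fun x y h => f.map_le x y h
    map_mon := fun x hx => f.map_fundamentalMonoid hB hC hx }⟩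

/-- A morphism from `G ∪ {0}` that is given by a homomorphism into the units. -/
noncomputable def ofGroupLift {G : Type v} [CommGroup G] (B : OrderedBlueprint.{u})
    (φ : G →* (B.mon)ˣ) : Hom (ofGroup G) B where
  toRingHom :=
    (MonoidAlgebra.lift ℕ B.carrier G ((B.mon.subtype.comp (Units.coeHom B.mon)).comp φ)).toRingHom
  map_le := by rintro x _ rfl; exact le_rfl
  map_mon := by
    rintro _ (rfl | ⟨g, -, rfl⟩)
    · exact (map_zero (MonoidAlgebra.lift ℕ B.carrier G
        ((B.mon.subtype.comp (Units.coeHom B.mon)).comp φ))).symm ▸ B.zero_mem'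
    · have : ((φ g : B.mon) : B.carrier) ∈ B.mon := (φ g : B.mon).2
      convert this
      exact MonoidAlgebra.lift_of _ _

theorem ofGroupLift_of {G : Type v} [CommGroup G] (B : OrderedBlueprint.{u}) (φ : G →* (B.mon)ˣ)
    (g : G) : (B.ofGroupLift φ).toRingHom (MonoidAlgebra.of ℕ G g) = ((φ g : B.mon) : B.carrier) :=
  MonoidAlgebra.lift_of _ _

/-- A morphism to a pasteurized ordered blueprint factors through the pasteurization. -/
def Hom.pasteurizationLift (f : Hom B C) (hC : C.IsPasteurized) : Hom B.pasteurization C :=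
  f.quotLift _ (by
    rintro a a' ⟨ha, ha', b, hb, h, h'⟩
    have key : ∀ a ∈ B.mon, 0 ≤ a + b →
        f.toRingHom a ∈ C.mon ∧ 0 ≤ f.toRingHom b + f.toRingHom a := fun a ha h => by
      refine ⟨f.map_mon a ha, ?_⟩
      rw [add_comm, ← map_add, ← map_zero f.toRingHom]
      exact f.map_le _ _ h
    exact ((hC _ (f.map_mon b hb)).unique (key a ha h) (key a' ha' h')).le)

end OrderedBlueprint

theorem map_pluckerExpr {E : Type*} [DecidableEq E] {R S : Type*} [CommSemiring R] [CommSemiring S]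
    (f : R →+* S) (e : R) (Δ : Finset E → R) (I : Finset E) (a b c d : E) :
    f (pluckerExpr e Δ I a b c d) = pluckerExpr (f e) (fun J => f (Δ J)) I a b c d := by
  simp [pluckerExpr]

theorem map_extendZero {E : Type*} {R S : Type*} [Semiring R] [Semiring S] (f : R →+* S) {r : ℕ}
    (Δ : {I : Finset E // I.card = r} → R) (J : Finset E) :
    f (extendZero Δ J) = extendZero (fun I => f (Δ I)) J := by
  unfold extendZero; split_ifs <;> simp

/-! ### Weak representability -/

/-- A matroid on all of `E` is determined by its bases, so the chosen underlying matroid is `M` as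
soon as the support is right. -/
theorem weaklyRepresentable_iff {E : Type v} [LinearOrder E] {M : Matroid E} (hM : M.E = Set.univ)
    {B : OrderedBlueprint.{u}} : WeaklyRepresentable M B ↔
      ∃ (r : ℕ) (Δ : {I : Finset E // I.card = r} → B.carrier), (∀ I, Δ I ∈ B.mon) ∧
        (∀ X : Set E, M.IsBase X ↔ ∃ I, Δ I ≠ 0 ∧ (I.1 : Set E) = X) ∧
        ∀ I i₁ i₂ i₃ i₄, IsPluckerIndex r I i₁ i₂ i₃ i₄ →
          0 ≤ pluckerExpr B.eps (extendZero Δ) I i₁ i₂ i₃ i₄ := by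
  constructor
  · rintro ⟨r, ⟨Δ⟩, rfl⟩
    exact ⟨r, Δ.toFun, Δ.mem_mon, Δ.exists_matroid.choose_spec.2, Δ.plucker⟩
  · rintro ⟨r, Δ, h₁, h₂, h₃⟩
    let Δ' : WeakGPFunction B E r := ⟨Δ, h₁, ⟨M, hM, h₂⟩, h₃⟩
    refine ⟨r, Quotient.mk _ Δ', ?_⟩
    have h := Δ'.exists_matroid.choose_spec
    exact Matroid.ext_isBase (h.1.trans hM.symm) fun X _ => (h.2 X).trans (h₂ X).symm

/-- A weak matroid over the foundation of `F` is a weak matroid over `F`. -/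
theorem WeaklyRepresentable.of_foundation {E : Type v} [LinearOrder E] {M : Matroid E}
    (hM : M.E = Set.univ) {F : OrderedBlueprint.{u}} (hF : F.IsPasteurized)
    (h : WeaklyRepresentable M F.foundation) : WeaklyRepresentable M F := by
  rw [weaklyRepresentable_iff hM] at h ⊢
  obtain ⟨r, Δ, h₁, h₂, h₃⟩ := h
  refine ⟨r, fun I => F.foundationIncl.toRingHom (Δ I), fun I => F.foundationIncl.map_mon _ (h₁ I),
    fun X => ?_, fun I i₁ i₂ i₃ i₄ h => ?_⟩
  · simp only [h₂ X, ne_eq, map_eq_zero_iff _ F.foundationIncl_injective]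
  · have := F.foundationIncl.map_le _ _ (h₃ I i₁ i₂ i₃ i₄ h)
    simpa only [map_pluckerExpr, map_zero, hF.foundationIncl_eps, map_extendZero] using this

/-! ### From weak representations to morphisms -/

section Universal

variable {E : Type v} [LinearOrder E] {M : Matroid E}

/-- The inclusion of the degree-`0` part. -/
noncomputable def weakResidueFieldIncl (M : Matroid E) :
    Hom (weakResidueField M) (pluckerBlueprint M) :=
  subIncl _ _ _ (Submonoid.monotone_map (by
    rintro x (rfl | ⟨g, -, rfl⟩)
    · exact Or.inl rfl
    · exact Or.inr ⟨g, trivial, rfl⟩))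

/-- A family of elements that satisfies the Plücker relations defines a morphism. -/
theorem exists_hom_pluckerBlueprint {F : OrderedBlueprint.{u}} (hF : F.IsPasteurized)
    {x : Finset E → F.carrier}
    (hx : ∀ J : Finset E, M.IsBase (J : Set E) → F.IsUnitOf (x J))
    (hx0 : ∀ J : Finset E, ¬ M.IsBase (J : Set E) → x J = 0)
    (hpl : ∀ (r : ℕ) (I : Finset E) (i₁ i₂ i₃ i₄ : E), M.eRank = r → IsPluckerIndex r I i₁ i₂ i₃ i₄ →
      0 ≤ pluckerExpr F.eps x I i₁ i₂ i₃ i₄) : Nonempty (Hom (pluckerBlueprint M) F) := by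
  have he := eps_spec hF.exists_eps
  let e : (F.mon)ˣ := ⟨⟨F.eps, he.1⟩, ⟨F.eps, he.1⟩, Subtype.ext hF.eps_mul_eps,
    Subtype.ext hF.eps_mul_eps⟩
  have hu : ∀ J : {I : Finset E // M.IsBase (I : Set E)}, ∃ u : (F.mon)ˣ,
      ((u : F.mon) : F.carrier) = x J := by
    rintro ⟨J, hJ⟩
    obtain ⟨ha, b, hb, hab⟩ := hx J hJ
    exact ⟨⟨⟨x J, ha⟩, ⟨b, hb⟩, Subtype.ext hab, Subtype.ext ((mul_comm _ _).trans hab)⟩, rfl⟩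
  choose y hy using hu
  -- The exponent of `ε` lives in `ZMod 2`, so sending `ε` to `e` requires `e ^ 2 = 1`.
  let g₁ : ZMod 2 →+ Additive (F.mon)ˣ := ZMod.lift 2 ⟨zmultiplesHom _ (Additive.ofMul e), by
    have : e ^ 2 = 1 := by ext; simpa [e, sq] using hF.eps_mul_eps
    simp only [zmultiplesHom_apply, natCast_zsmul, ← ofMul_pow, this, ofMul_one]⟩
  let g₂ : ({I : Finset E // M.IsBase (I : Set E)} →₀ ℤ) →+ Additive (F.mon)ˣ :=
    Finsupp.liftAddHom fun J => zmultiplesHom _ (Additive.ofMul (y J))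
  let φ : LaurentMonomials M →* (F.mon)ˣ := AddMonoidHom.toMultiplicativeLeft (g₁.coprod g₂)
  have h₁ : (F.ofGroupLift φ).toRingHom (epsVar M) = F.eps := by
    refine (F.ofGroupLift_of φ _).trans ?_
    have : φ (Multiplicative.ofAdd (1, 0)) = e := by
      change (g₁ 1 + g₂ 0).toMul = e
      rw [map_zero, add_zero]
      have := ZMod.lift_coe 2 (A := Additive (F.mon)ˣ) ⟨zmultiplesHom _ (Additive.ofMul e), by
        have : e ^ 2 = 1 := by ext; simpa [e, sq] using hF.eps_mul_eps
        simp only [zmultiplesHom_apply, natCast_zsmul, ← ofMul_pow, this, ofMul_one]⟩ 1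
      rw [Int.cast_one] at this
      rw [this]
      simp
    rw [this]
  have h₂ : ∀ J, (F.ofGroupLift φ).toRingHom (basisVar M J) = x J := by
    intro J
    by_cases hJ : M.IsBase (J : Set E)
    · rw [basisVar, dif_pos hJ]
      refine (F.ofGroupLift_of φ _).trans ?_
      have : φ (Multiplicative.ofAdd (0, Finsupp.single ⟨J, hJ⟩ 1)) = y ⟨J, hJ⟩ := by
        change (g₁ 0 + g₂ (Finsupp.single ⟨J, hJ⟩ 1)).toMul = _
        simp [g₂]
      rw [this, hy]
    · rw [basisVar, dif_neg hJ, hx0 J hJ]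
      exact map_zero _
  refine ⟨(F.ofGroupLift φ).quotLift _ ?_⟩
  rintro _ _ ⟨rfl, rfl | ⟨r, I, i₁, i₂, i₃, i₄, hr, hI, rfl⟩⟩
  · have : (F.ofGroupLift φ).toRingHom (1 + epsVar M : MonoidAlgebra ℕ (LaurentMonomials M)) = 1 + F.eps := by
      rw [← h₁, ← map_one (F.ofGroupLift φ).toRingHom]
      exact map_add _ _ _
    exact (map_zero _).trans_le (he.2.trans_eq this.symm)
  · have := map_pluckerExpr (F.ofGroupLift φ).toRingHom (epsVar M) (basisVar M) I i₁ i₂ i₃ i₄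
    simp only [h₁, h₂] at this
    exact (map_zero _).trans_le ((hpl r I i₁ i₂ i₃ i₄ hr hI).trans_eq this.symm)

/-- A weak representation of `M` over `F` defines a morphism from the foundation of `M` to `F`. -/
theorem WeaklyRepresentable.nonempty_hom (hM : M.E = Set.univ) {F : OrderedBlueprint.{u}}
    (hF : F.IsPasture) (h : WeaklyRepresentable M F) : Nonempty (Hom (matroidFoundation M) F) := by
  obtain ⟨r, Δ, h₁, h₂, h₃⟩ := (weaklyRepresentable_iff hM).1 h
  have hr : M.eRank = r := by
    obtain ⟨X, hX⟩ := M.exists_isBase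
    obtain ⟨I, -, rfl⟩ := (h₂ X).1 hX
    rw [← hX.encard_eq_eRank, Set.encard_coe_eq_coe_finsetCard, I.2]
  have hb : ∀ J : Finset E, M.IsBase (J : Set E) ↔ extendZero Δ J ≠ 0 := by
    intro J
    rw [h₂]
    constructor
    · rintro ⟨⟨I, hI⟩, hI0, hIJ⟩
      obtain rfl : I = J := Finset.coe_injective hIJ
      rwa [extendZero, dif_pos hI]
    · intro h
      unfold extendZero at h
      split_ifs at h with hJ
      · exact ⟨⟨J, hJ⟩, h, rfl⟩
      · exact absurd rfl h
  obtain ⟨f⟩ := exists_hom_pluckerBlueprint (M := M) hF.pasteurized (x := extendZero Δ)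
    (fun J hJ => by
      have hJ' := (hb J).1 hJ
      refine (hF.blueField _ ?_).resolve_left hJ'
      unfold extendZero
      split_ifs
      · exact h₁ _
      · exact F.zero_mem')
    (fun J hJ => by_contra fun h => hJ ((hb J).2 h))
    (fun s I i₁ i₂ i₃ i₄ hs hI => h₃ I i₁ i₂ i₃ i₄ (by
      rw [hr, Nat.cast_inj] at hs
      rwa [hs]))
  exact ⟨((f.comp (weakResidueFieldIncl M)).pasteurizationLift hF.pasteurized).comp
    (foundationIncl _)⟩

end Universal

/-! ### Laurent monomials and their degrees -/

section Laurent

variable {E : Type v} {M : Matroid E}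

/-- The semiring of Laurent polynomials of degree `0`. -/
noncomputable def degreeZero (M : Matroid E) : Subsemiring (MonoidAlgebra ℕ (LaurentMonomials M)) :=
  Subsemiring.closure (monomials (degree M).ker : Set (MonoidAlgebra ℕ (LaurentMonomials M)))

/-- A monomial of degree `0`. -/
noncomputable def degreeZeroOf (t : LaurentMonomials M) (h : degree M t = 1) : degreeZero M :=
  ⟨MonoidAlgebra.of ℕ _ t, Subsemiring.subset_closure (Or.inr ⟨t, h, rfl⟩)⟩

theorem degreeZeroOf_mul (s t : LaurentMonomials M) (hs : degree M s = 1) (ht : degree M t = 1)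
    (h : degree M (s * t) = 1) : degreeZeroOf (s * t) h = degreeZeroOf s hs * degreeZeroOf t ht :=
  Subtype.ext (map_mul (MonoidAlgebra.of ℕ _) s t)

/-- The Laurent monomial `ε`. -/
noncomputable def epsMonomial (M : Matroid E) : LaurentMonomials M := Multiplicative.ofAdd (1, 0)

/-- The Laurent monomial `x_I`. -/
noncomputable def basisMonomial (I : Finset E) (h : M.IsBase (I : Set E)) : LaurentMonomials M :=
  Multiplicative.ofAdd (0, Finsupp.single ⟨I, h⟩ 1)

theorem degree_epsMonomial : degree M (epsMonomial M) = 1 := by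
  change Multiplicative.ofAdd (Finsupp.liftAddHom
    (fun _ : {I : Finset E // M.IsBase (I : Set E)} => AddMonoidHom.id ℤ) 0) = 1
  rw [map_zero]; rfl

theorem degree_basisMonomial (I : Finset E) (h : M.IsBase (I : Set E)) :
    degree M (basisMonomial I h) = Multiplicative.ofAdd 1 := by
  change Multiplicative.ofAdd (Finsupp.liftAddHom
    (fun _ : {I : Finset E // M.IsBase (I : Set E)} => AddMonoidHom.id ℤ)
    (Finsupp.single ⟨I, h⟩ 1)) = _
  rw [Finsupp.liftAddHom_apply_single]; rfl

theorem basisVar_eq (I : Finset E) (h : M.IsBase (I : Set E)) :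
    basisVar M I = MonoidAlgebra.of ℕ _ (basisMonomial I h) := dif_pos h

theorem basisVar_eq_zero (I : Finset E) (h : ¬ M.IsBase (I : Set E)) : basisVar M I = 0 := dif_neg h

/-- This is the form required of the third term of a Plücker relation, which may vanish, when the
relation is divided by another term. -/
theorem mul_basisVar (J K : Finset E) (e : LaurentMonomials M) (he : degree M e = 1) :
    MonoidAlgebra.of ℕ _ e * (basisVar M J * basisVar M K) = 0 ∨
      ∃ q, degree M q = Multiplicative.ofAdd 2 ∧
        MonoidAlgebra.of ℕ _ e * (basisVar M J * basisVar M K) = MonoidAlgebra.of ℕ _ q := by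
  by_cases hJ : M.IsBase (J : Set E)
  · by_cases hK : M.IsBase (K : Set E)
    · refine Or.inr ⟨e * (basisMonomial J hJ * basisMonomial K hK), ?_, ?_⟩
      · rw [map_mul, map_mul, degree_basisMonomial, degree_basisMonomial, he, one_mul]; rfl
      · rw [basisVar_eq J hJ, basisVar_eq K hK, map_mul, map_mul]
    · left; rw [basisVar_eq_zero K hK, mul_zero, mul_zero]
  · left; rw [basisVar_eq_zero J hJ, zero_mul, mul_zero]

theorem degree_mul_basisMonomial (J K : Finset E) (hJ : M.IsBase (J : Set E))
    (hK : M.IsBase (K : Set E)) :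
    degree M (basisMonomial J hJ * basisMonomial K hK) = Multiplicative.ofAdd 2 := by
  rw [map_mul, degree_basisMonomial, degree_basisMonomial]; rfl

end Laurent

/-! ### Fundamental elements from Plücker relations -/

section Universal

variable {E : Type v} [LinearOrder E] (M : Matroid E)

/-- The quotient map to `𝔽₁^±[x_I^{±1} | I a basis of M] // Pl^w`. -/
noncomputable def toPlucker : MonoidAlgebra ℕ (LaurentMonomials M) →+* (pluckerBlueprint M).carrier :=
  ((ofGroup (LaurentMonomials M)).genCon (PluckerRel M)).mk'

theorem toPlucker_mem (x : degreeZero M) : toPlucker M x ∈ Subsemiring.closure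
    ((monomials (degree M).ker).map (toPlucker M) : Set (pluckerBlueprint M).carrier) := by
  rw [Submonoid.coe_map]
  have := RingHom.map_closureS (toPlucker M)
    (monomials (degree M).ker : Set (MonoidAlgebra ℕ (LaurentMonomials M)))
  exact this ▸ ⟨x, x.2, rfl⟩

/-- The map from the Laurent polynomials of degree `0` to the degree-`0` part of
`𝔽₁^±[x_I^{±1} | I a basis of M] // Pl^w`. -/
noncomputable def toWeakResidueField : degreeZero M →+* (weakResidueField M).carrier :=
  ((toPlucker M).comp (degreeZero M).subtype).codRestrict (Subsemiring.closure
    ((monomials (degree M).ker).map (toPlucker M) : Set (pluckerBlueprint M).carrier))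
    (toPlucker_mem M)

/-- The map from the Laurent polynomials of degree `0` to the weak universal pasture. -/
noncomputable def toUniversalPasture : degreeZero M →+* (weakUniversalPasture M).carrier :=
  RingHom.comp ((weakResidueField M).genCon _).mk' (toWeakResidueField M)

variable {M}

/-- The degree-0 part carries the restricted order and pasteurization only adds relations, so
positivity can be checked in the Plücker blueprint. -/
theorem toUniversalPasture_nonneg {x : degreeZero M} (h : 0 ≤ toPlucker M x) :
    0 ≤ toUniversalPasture M x :=
  Gen.of_le (B := weakResidueField M) h

theorem toUniversalPasture_mem {x : degreeZero M}
    (h : (x : MonoidAlgebra ℕ (LaurentMonomials M)) ∈ monomials (degree M).ker) :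
    toUniversalPasture M x ∈ (weakUniversalPasture M).mon :=
  ⟨toWeakResidueField M x, ⟨x.1, h, rfl⟩, rfl⟩

theorem toPlucker_mul_nonneg {x : MonoidAlgebra ℕ (LaurentMonomials M)} (h : 0 ≤ toPlucker M x)
    (y : MonoidAlgebra ℕ (LaurentMonomials M)) : 0 ≤ toPlucker M (x * y) := by
  have := (pluckerBlueprint M).mul_le_mul' _ _ _ _ h (le_refl (toPlucker M y))
  rwa [zero_mul, ← map_mul] at this

theorem degreeZeroOf_mem (t : LaurentMonomials M) (h : degree M t = 1) :
    toUniversalPasture M (degreeZeroOf t h) ∈ (weakUniversalPasture M).mon :=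
  toUniversalPasture_mem (Or.inr ⟨t, h, rfl⟩)

variable (M) in
/-- The Laurent monomials of degree `0` that are products of fundamental elements in the weak
universal pasture, together with their inverses. -/
noncomputable def fundamentalSubgroup : Subgroup (LaurentMonomials M) where
  carrier := {t | ∃ (h : degree M t = 1) (h' : degree M t⁻¹ = 1),
    toUniversalPasture M (degreeZeroOf t h) ∈ (weakUniversalPasture M).fundamentalMonoid ∧
    toUniversalPasture M (degreeZeroOf t⁻¹ h') ∈ (weakUniversalPasture M).fundamentalMonoid}
  one_mem' := by
    have h : toUniversalPasture M (degreeZeroOf 1 (map_one _)) ∈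
        (weakUniversalPasture M).fundamentalMonoid := by
      have : degreeZeroOf (M := M) 1 (map_one _) = 1 := Subtype.ext (map_one (MonoidAlgebra.of ℕ _))
      rw [this, map_one]
      exact one_mem _
    exact ⟨map_one _, by simp, h, by simpa only [inv_one] using h⟩
  mul_mem' := by
    rintro s t ⟨hs, hs', h₁, h₂⟩ ⟨ht, ht', h₃, h₄⟩
    refine ⟨by rw [map_mul, hs, ht, one_mul], by rw [mul_inv, map_mul, hs', ht', one_mul], ?_, ?_⟩
    · rw [degreeZeroOf_mul s t hs ht, map_mul]
      exact mul_mem h₁ h₃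
    · simp only [mul_inv]
      rw [degreeZeroOf_mul s⁻¹ t⁻¹ hs' ht', map_mul]
      exact mul_mem h₂ h₄
  inv_mem' := by
    rintro s ⟨hs, hs', h₁, h₂⟩
    exact ⟨hs', by rwa [inv_inv], h₂, by simpa only [inv_inv] using h₁⟩

/-- A sum of monomials `s + t + z` of the same degree that is nonnegative defines a fundamental
element `t / s`. -/
theorem isFundamental_div {s t : LaurentMonomials M} {z : MonoidAlgebra ℕ (LaurentMonomials M)}
    (hz : z = 0 ∨ ∃ q, degree M q = degree M s ∧ z = MonoidAlgebra.of ℕ _ q)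
    (h : 0 ≤ toPlucker M (MonoidAlgebra.of ℕ _ s + MonoidAlgebra.of ℕ _ t + z))
    (hts : degree M (t * s⁻¹) = 1) :
    (weakUniversalPasture M).IsFundamental (toUniversalPasture M (degreeZeroOf (t * s⁻¹) hts)) := by
  have hz' : ∃ y : degreeZero M,
      (y : MonoidAlgebra ℕ (LaurentMonomials M)) ∈ monomials (degree M).ker ∧
      (y : MonoidAlgebra ℕ (LaurentMonomials M)) = z * MonoidAlgebra.of ℕ _ s⁻¹ := by
    rcases hz with rfl | ⟨q, hq, rfl⟩
    · exact ⟨0, Or.inl rfl, by simp⟩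
    · have hq' : degree M (q * s⁻¹) = 1 := by rw [map_mul, map_inv, hq, mul_inv_cancel]
      exact ⟨degreeZeroOf (q * s⁻¹) hq', Or.inr ⟨_, hq', rfl⟩, map_mul _ _ _⟩
  obtain ⟨y, hy, hy'⟩ := hz'
  refine isFundamental_of_nonneg (degreeZeroOf_mem _ _) (toUniversalPasture_mem hy) ?_
  rw [← map_one (toUniversalPasture M), ← map_add, ← map_add]
  refine toUniversalPasture_nonneg ?_
  convert toPlucker_mul_nonneg h (MonoidAlgebra.of ℕ _ s⁻¹) using 2
  rw [add_mul, add_mul, ← map_mul, ← map_mul, mul_inv_cancel, map_one]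
  push_cast
  rw [hy', degreeZeroOf]
  ring

/-- The relation can be divided by `s` or by `t`, so both `t / s` and its inverse are fundamental.
-/
theorem div_mem_fundamentalSubgroup {s t : LaurentMonomials M}
    {z : MonoidAlgebra ℕ (LaurentMonomials M)} (hst : degree M s = degree M t)
    (hz : z = 0 ∨ ∃ q, degree M q = degree M s ∧ z = MonoidAlgebra.of ℕ _ q)
    (h : 0 ≤ toPlucker M (MonoidAlgebra.of ℕ _ s + MonoidAlgebra.of ℕ _ t + z)) :
    t * s⁻¹ ∈ fundamentalSubgroup M := by
  have h₁ : degree M (t * s⁻¹) = 1 := by rw [map_mul, map_inv, hst, mul_inv_cancel]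
  have h₂ : degree M (s * t⁻¹) = 1 := by rw [map_mul, map_inv, hst, mul_inv_cancel]
  have e : (t * s⁻¹)⁻¹ = s * t⁻¹ := by rw [mul_inv, inv_inv, mul_comm]
  refine ⟨h₁, by rwa [e], mem_foundation_of_isFundamental (isFundamental_div hz h h₁), ?_⟩
  simp only [e]
  rw [hst] at hz
  rw [add_comm (MonoidAlgebra.of ℕ _ s)] at h
  exact mem_foundation_of_isFundamental (isFundamental_div hz h h₂)

theorem toPlucker_one_add_eps : 0 ≤ toPlucker M (1 + epsVar M) :=
  Gen.of_rel (B := ofGroup (LaurentMonomials M)) ⟨rfl, Or.inl rfl⟩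

theorem epsMonomial_mem : epsMonomial M ∈ fundamentalSubgroup M := by
  have := div_mem_fundamentalSubgroup (M := M) (s := 1) (t := epsMonomial M) (z := 0)
    (by rw [degree_epsMonomial, map_one]) (Or.inl rfl)
    (by rw [add_zero, map_one]; exact toPlucker_one_add_eps)
  simpa using this

theorem toPlucker_pluckerExpr {r : ℕ} (hr : M.eRank = r) {I : Finset E} {i₁ i₂ i₃ i₄ : E}
    (h : IsPluckerIndex r I i₁ i₂ i₃ i₄) :
    0 ≤ toPlucker M (pluckerExpr (epsVar M) (basisVar M) I i₁ i₂ i₃ i₄) :=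
  Gen.of_rel (B := ofGroup (LaurentMonomials M)) ⟨rfl, Or.inr ⟨r, I, i₁, i₂, i₃, i₄, hr, h, rfl⟩⟩

open Classical in
/-- The class of `x_I` modulo products of fundamental elements, and `0` if `I` is not a basis. -/
noncomputable def basisClass (M : Matroid E) (I : Finset E) :
    Additive (LaurentMonomials M ⧸ fundamentalSubgroup M) :=
  if h : M.IsBase (I : Set E) then
    Additive.ofMul (QuotientGroup.mk (basisMonomial I h)) else 0

theorem basisClass_add_eq {J K J' K' : Finset E} (hJ : M.IsBase (J : Set E))
    (hK : M.IsBase (K : Set E)) (hJ' : M.IsBase (J' : Set E)) (hK' : M.IsBase (K' : Set E))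
    (h : basisMonomial J hJ * basisMonomial K hK * (basisMonomial J' hJ' * basisMonomial K' hK')⁻¹ ∈
      fundamentalSubgroup M) :
    basisClass M J + basisClass M K = basisClass M J' + basisClass M K' := by
  have : (QuotientGroup.mk (basisMonomial J hJ * basisMonomial K hK) :
      LaurentMonomials M ⧸ fundamentalSubgroup M) =
      QuotientGroup.mk (basisMonomial J' hJ' * basisMonomial K' hK') := by
    rw [eq_comm, QuotientGroup.eq, mul_comm]
    exact h
  simp only [basisClass, dif_pos hJ, dif_pos hK, dif_pos hJ', dif_pos hK']
  exact congrArg Additive.ofMul this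

/-- The cross ratios of `M` are products of fundamental elements. -/
theorem basisClass_plucker {r : ℕ} (hr : M.eRank = r) {I : Finset E} {i₁ i₂ i₃ i₄ : E}
    (hI : IsPluckerIndex r I i₁ i₂ i₃ i₄) :
    (M.IsBase ↑(I ∪ {i₁, i₂}) → M.IsBase ↑(I ∪ {i₃, i₄}) → M.IsBase ↑(I ∪ {i₁, i₃}) →
      M.IsBase ↑(I ∪ {i₂, i₄}) → basisClass M (I ∪ {i₁, i₂}) + basisClass M (I ∪ {i₃, i₄}) =
        basisClass M (I ∪ {i₁, i₃}) + basisClass M (I ∪ {i₂, i₄})) ∧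
    (M.IsBase ↑(I ∪ {i₁, i₂}) → M.IsBase ↑(I ∪ {i₃, i₄}) → M.IsBase ↑(I ∪ {i₁, i₄}) →
      M.IsBase ↑(I ∪ {i₂, i₃}) → basisClass M (I ∪ {i₁, i₂}) + basisClass M (I ∪ {i₃, i₄}) =
        basisClass M (I ∪ {i₁, i₄}) + basisClass M (I ∪ {i₂, i₃})) ∧
    (M.IsBase ↑(I ∪ {i₁, i₃}) → M.IsBase ↑(I ∪ {i₂, i₄}) → M.IsBase ↑(I ∪ {i₁, i₄}) →
      M.IsBase ↑(I ∪ {i₂, i₃}) → basisClass M (I ∪ {i₁, i₃}) + basisClass M (I ∪ {i₂, i₄}) =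
        basisClass M (I ∪ {i₁, i₄}) + basisClass M (I ∪ {i₂, i₃})) := by
  have hP := toPlucker_pluckerExpr hr hI
  have he : epsVar M = MonoidAlgebra.of ℕ _ (epsMonomial M) := rfl
  have h1 : (MonoidAlgebra.of ℕ (LaurentMonomials M)) 1 = 1 := map_one _
  unfold pluckerExpr at hP
  -- Each part takes two terms as `s` and `t` and the remaining one as `z`. A factor `ε` in `s` or
  -- `t` is removed since `ε` lies in the subgroup.
  refine ⟨fun h₁ h₂ h₃ h₄ => ?_, fun h₁ h₂ h₃ h₄ => ?_, fun h₁ h₂ h₃ h₄ => ?_⟩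
  · refine (basisClass_add_eq h₃ h₄ h₁ h₂ ?_).symm
    have hz := mul_basisVar (I ∪ {i₁, i₄}) (I ∪ {i₂, i₃}) (1 : LaurentMonomials M) (map_one _)
    rw [h1, one_mul] at hz
    rw [basisVar_eq _ h₁, basisVar_eq _ h₂, basisVar_eq _ h₃, basisVar_eq _ h₄, he, ← map_mul,
      ← map_mul, ← map_mul] at hP
    have := mul_mem (inv_mem epsMonomial_mem) (div_mem_fundamentalSubgroup (by
      rw [map_mul (degree M) (epsMonomial M), degree_epsMonomial, one_mul, degree_mul_basisMonomial, degree_mul_basisMonomial])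
      (by rwa [degree_mul_basisMonomial]) hP)
    rwa [mul_assoc, inv_mul_cancel_left] at this
  · refine (basisClass_add_eq h₃ h₄ h₁ h₂ ?_).symm
    have hz := mul_basisVar (I ∪ {i₁, i₃}) (I ∪ {i₂, i₄}) (epsMonomial M) degree_epsMonomial
    rw [basisVar_eq _ h₁, basisVar_eq _ h₂, basisVar_eq _ h₃, basisVar_eq _ h₄, he, ← map_mul,
      ← map_mul, add_right_comm] at hP
    exact div_mem_fundamentalSubgroup (by
      rw [degree_mul_basisMonomial, degree_mul_basisMonomial])
      (by rwa [degree_mul_basisMonomial]) hP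
  · refine (basisClass_add_eq h₃ h₄ h₁ h₂ ?_).symm
    have hz := mul_basisVar (I ∪ {i₁, i₂}) (I ∪ {i₃, i₄}) (1 : LaurentMonomials M) (map_one _)
    rw [h1, one_mul] at hz
    rw [basisVar_eq _ h₁, basisVar_eq _ h₂, basisVar_eq _ h₃, basisVar_eq _ h₄, he, ← map_mul,
      ← map_mul, ← map_mul, add_assoc, add_comm] at hP
    have := mul_mem epsMonomial_mem (div_mem_fundamentalSubgroup (by
      rw [map_mul (degree M) (epsMonomial M), degree_epsMonomial, one_mul, degree_mul_basisMonomial, degree_mul_basisMonomial])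
      (by rwa [map_mul, degree_epsMonomial, one_mul, degree_mul_basisMonomial]) hP)
    rwa [mul_inv, mul_left_comm, mul_inv_cancel_left] at this

/-- A property of quadruples with the symmetries of an identity between two of the three products in
a three-term Plücker relation only has to be verified for increasing quadruples. -/
theorem forall_of_sorted {Q : E → E → E → E → Prop} (h₁ : ∀ a b c d, Q a b c d → Q a c b d)
    (h₂ : ∀ a b c d, Q a b c d → Q b a d c) (h₃ : ∀ a b c d, Q a b c d → Q c d a b)
    (hs : ∀ a b c d, a < b → b < c → c < d → Q a b c d ∧ Q a b d c ∧ Q a c d b) {a b c d : E}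
    (hab : a ≠ b) (hac : a ≠ c) (had : a ≠ d) (hbc : b ≠ c) (hbd : b ≠ d) (hcd : c ≠ d) :
    Q a b c d := by
  -- The symmetries generate a dihedral group of order 8, so the 24 orderings fall into three
  -- classes, one for each product left out. `h₂` and `h₃` move the minimum to the first place, and
  -- `h₁` then orders the two middle entries.
  have k₁ : ∀ a b c d, a < b → a < d → b < c → b ≠ d → c ≠ d → Q a b c d := by
    intro a b c d hab had hbc hbd hcd
    rcases hcd.lt_or_gt with h | h
    · exact (hs a b c d hab hbc h).1
    rcases hbd.lt_or_gt with h' | h'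
    · exact (hs a b d c hab h' h).2.1
    · exact (hs a d b c had h' hbc).2.2
  have k₂ : ∀ a b c d, a < b → a < c → a < d → b ≠ c → b ≠ d → c ≠ d → Q a b c d := by
    intro a b c d hab hac had hbc hbd hcd
    rcases hbc.lt_or_gt with h | h
    · exact k₁ a b c d hab had h hbd hcd
    · exact h₁ _ _ _ _ (k₁ a c b d hac had h hcd hbd)
  rcases hab.lt_or_gt with h | h <;> rcases hcd.lt_or_gt with h' | h'
  · rcases hac.lt_or_gt with h'' | h''
    · exact k₂ _ _ _ _ h h'' (h''.trans h') hbc hbd hcd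
    · exact h₃ _ _ _ _ (k₂ _ _ _ _ h' h'' (h''.trans h) had.symm hbd.symm hab)
  · rcases had.lt_or_gt with h'' | h''
    · exact k₂ _ _ _ _ h (h''.trans h') h'' hbc hbd hcd
    · exact h₂ _ _ _ _ (h₃ _ _ _ _ (k₂ _ _ _ _ h' (h''.trans h) h'' hbc.symm hac.symm hab.symm))
  · rcases hbc.lt_or_gt with h'' | h''
    · exact h₂ _ _ _ _ (k₂ _ _ _ _ h (h''.trans h') h'' had hac hcd.symm)
    · exact h₃ _ _ _ _ (k₂ _ _ _ _ h' (h''.trans h) h'' had.symm hbd.symm hab)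
  · rcases hbd.lt_or_gt with h'' | h''
    · exact h₂ _ _ _ _ (k₂ _ _ _ _ h h'' (h''.trans h') had hac hcd.symm)
    · exact h₂ _ _ _ _ (h₃ _ _ _ _ (k₂ _ _ _ _ h' h'' (h''.trans h) hbc.symm hac.symm hab.symm))

theorem finsetExchange_isBase (M : Matroid E) :
    FinsetExchange fun J : Finset E => M.IsBase (J : Set E) := by
  intro B B' hB hB' a ha ha'
  obtain ⟨b, ⟨hb, hb'⟩, h⟩ := hB.exchange hB' (e := a) ⟨ha, ha'⟩
  refine ⟨b, hb, hb', ?_⟩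
  change M.IsBase ((insert b (B.erase a) : Finset E) : Set E)
  rwa [Finset.coe_insert, Finset.coe_erase]

theorem locallyModular_basisClass (M : Matroid E) :
    LocallyModular (fun J : Finset E => M.IsBase (J : Set E)) (basisClass M) := by
  intro I a b c d ha hb hc hd hab hac had hbc hbd hcd
  have key := forall_of_sorted (E := E) (Q := fun a b c d => a ∉ I → b ∉ I → c ∉ I → d ∉ I →
    M.IsBase ↑(I ∪ {a, b}) → M.IsBase ↑(I ∪ {c, d}) → M.IsBase ↑(I ∪ {a, c}) →
      M.IsBase ↑(I ∪ {b, d}) → basisClass M (I ∪ {a, b}) + basisClass M (I ∪ {c, d}) =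
        basisClass M (I ∪ {a, c}) + basisClass M (I ∪ {b, d}))
    (fun a b c d h ha hb hc hd h₁ h₂ h₃ h₄ => (h ha hc hb hd h₃ h₄ h₁ h₂).symm)
    (fun a b c d h ha hb hc hd => by
      simpa only [Finset.pair_comm b a, Finset.pair_comm d c,
        add_comm (basisClass M (I ∪ {a, c}))] using fun h₁ h₂ h₃ h₄ => h hb ha hd hc h₁ h₂ h₄ h₃)
    (fun a b c d h ha hb hc hd => by
      simpa only [Finset.pair_comm c a, Finset.pair_comm d b,
        add_comm (basisClass M (I ∪ {a, b}))] using fun h₁ h₂ h₃ h₄ => h hc hd ha hb h₂ h₁ h₃ h₄)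
    (fun a b c d h₁ h₂ h₃ => by
      have hr : a ∉ I → b ∉ I → M.IsBase ↑(I ∪ {a, b}) → M.eRank = (I.card + 2 : ℕ) := by
        intro ha hb h
        rw [← h.encard_eq_eRank, Set.encard_coe_eq_coe_finsetCard,
          Finset.card_union_of_disjoint (by simp [ha, hb]), Finset.card_pair h₁.ne]
      have hr' : a ∉ I → c ∉ I → M.IsBase ↑(I ∪ {a, c}) → M.eRank = (I.card + 2 : ℕ) := by
        intro ha hb h
        rw [← h.encard_eq_eRank, Set.encard_coe_eq_coe_finsetCard,
          Finset.card_union_of_disjoint (by simp [ha, hb]), Finset.card_pair (h₁.trans h₂).ne]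
      refine ⟨fun ha hb hc hd p => ?_, fun ha hb hd hc p => ?_, fun ha hc hd hb p => ?_⟩
      · exact (basisClass_plucker (hr ha hb p) ⟨rfl, h₁, h₂, h₃, ha, hb, hc, hd⟩).1 p
      · have := (basisClass_plucker (hr ha hb p) ⟨rfl, h₁, h₂, h₃, ha, hb, hc, hd⟩).2.1 p
        rwa [Finset.pair_comm d c]
      · have := (basisClass_plucker (hr' ha hc p) ⟨rfl, h₁, h₂, h₃, ha, hb, hc, hd⟩).2.2 p
        rwa [Finset.pair_comm d b, Finset.pair_comm c b])
    hab hac had hbc hbd hcd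
  exact key ha hb hc hd

/-- The monomials `x_I` can be rescaled by monomials that are multiplicative in `I` to products of
fundamental elements. -/
theorem exists_rescaling (M : Matroid E) : ∃ (c : LaurentMonomials M) (w : E → LaurentMonomials M),
    ∀ (J : Finset E) (h : M.IsBase (J : Set E)),
      basisMonomial J h * (c * ∏ i ∈ J, w i)⁻¹ ∈ fundamentalSubgroup M := by
  obtain ⟨c, w, h⟩ := (locallyModular_basisClass M).exists_weight (finsetExchange_isBase M)
  obtain ⟨c', hc'⟩ := QuotientGroup.mk_surjective (s := fundamentalSubgroup M) c.toMul
  have hw : ∀ e, ∃ t : LaurentMonomials M,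
      (QuotientGroup.mk t : LaurentMonomials M ⧸ fundamentalSubgroup M) = (w e).toMul :=
    fun e => QuotientGroup.mk_surjective _
  choose w' hw' using hw
  refine ⟨c', w', fun J hJ => ?_⟩
  have := congrArg Additive.toMul (h J hJ)
  rw [basisClass, dif_pos hJ, toMul_ofMul, toMul_add, toMul_sum, ← hc'] at this
  simp only [← hw'] at this
  have e : ∏ i ∈ J, (QuotientGroup.mk (w' i) : LaurentMonomials M ⧸ fundamentalSubgroup M) =
      QuotientGroup.mk (∏ i ∈ J, w' i) :=
    (map_prod (QuotientGroup.mk' (fundamentalSubgroup M)) _ _).symm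
  rw [e, ← QuotientGroup.mk_mul, eq_comm, QuotientGroup.eq, mul_comm] at this
  exact this

/-- A morphism from the foundation of `M` into an ordered blueprint in which `1` has a unique weak
inverse defines a weak representation of `M`. -/
theorem WeaklyRepresentable.of_hom [Finite E] (hM : M.E = Set.univ) {F : OrderedBlueprint.{u}}
    (h01 : (0 : F.carrier) ≠ 1) (hF : ∀ e ∈ F.mon, 0 ≤ 1 + e → e = F.eps)
    (f : Hom (matroidFoundation M) F) : WeaklyRepresentable M F := by
  classical
  obtain ⟨c, w, hw⟩ := exists_rescaling M
  -- Dividing `x_J` by `s J` gives elements `Y J` that lie in the foundation of `M`.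
  let s : Finset E → LaurentMonomials M := fun J => c * ∏ i ∈ J, w i
  let Y : Finset E → degreeZero M := fun J =>
    if h : M.IsBase (J : Set E) then degreeZeroOf (basisMonomial J h * (s J)⁻¹) (hw J h).1 else 0
  have hYval : ∀ J, (Y J : MonoidAlgebra ℕ (LaurentMonomials M)) =
      basisVar M J * MonoidAlgebra.of ℕ _ (s J)⁻¹ := by
    intro J
    by_cases h : M.IsBase (J : Set E)
    · simp only [Y, dif_pos h, basisVar_eq J h, degreeZeroOf, map_mul]
    · simp only [Y, dif_neg h, basisVar_eq_zero J h, zero_mul]; rfl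
  have hY : ∀ J, toUniversalPasture M (Y J) ∈ (weakUniversalPasture M).fundamentalMonoid := by
    intro J
    by_cases h : M.IsBase (J : Set E)
    · simp only [Y, dif_pos h]
      exact (hw J h).2.2.1
    · simp only [Y, dif_neg h, map_zero]
      exact Submonoid.subset_closure (Or.inl rfl)
  let Z : Finset E → (matroidFoundation M).carrier := fun J =>
    (weakUniversalPasture M).toFoundation _ (hY J)
  let e : (matroidFoundation M).carrier :=
    (weakUniversalPasture M).toFoundation _ (epsMonomial_mem (M := M)).2.2.1
  have he : f.toRingHom e = F.eps := by
    refine hF _ (f.map_mon _ (toFoundation_mem _ _)) ?_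
    rw [← map_zero f.toRingHom, ← map_one f.toRingHom, ← map_add]
    refine f.map_le _ _ ?_
    change 0 ≤ 1 + toUniversalPasture M (degreeZeroOf (epsMonomial M) degree_epsMonomial)
    rw [← map_one (toUniversalPasture M), ← map_add]
    exact toUniversalPasture_nonneg toPlucker_one_add_eps
  have hZ0 : ∀ J : Finset E, ¬ M.IsBase (J : Set E) → f.toRingHom (Z J) = 0 := by
    intro J h
    have : Z J = 0 := by
      refine Subtype.ext ?_
      change toUniversalPasture M (Y J) = 0
      simp only [Y, dif_neg h, map_zero]
    rw [this, map_zero]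
  have hZ1 : ∀ J : Finset E, M.IsBase (J : Set E) → f.toRingHom (Z J) ≠ 0 := by
    intro J h h0
    obtain ⟨h₁, h₂, h₃, h₄⟩ := hw J h
    -- The subgroup also contains the inverse of `x_J / s J`, so `Z J` is invertible in the
    -- foundation and its image is nonzero.
    let Z' : (matroidFoundation M).carrier := (weakUniversalPasture M).toFoundation _ h₄
    have : Z J * Z' = 1 := by
      refine Subtype.ext ?_
      change toUniversalPasture M (Y J) * toUniversalPasture M (degreeZeroOf _ h₂) = 1
      rw [← map_mul, ← map_one (toUniversalPasture M)]
      congr 1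
      refine Subtype.ext ?_
      simp only [Y, dif_pos h, s]
      change MonoidAlgebra.of ℕ _ _ * MonoidAlgebra.of ℕ _ _ = 1
      rw [← map_mul, mul_inv_cancel, map_one]
    have := congrArg f.toRingHom this
    rw [map_mul, h0, zero_mul, map_one] at this
    exact h01 this
  obtain ⟨r, hr⟩ : ∃ r : ℕ, M.eRank = r := by
    obtain ⟨X, hX⟩ := M.exists_isBase
    exact ⟨X.ncard, by rw [← hX.encard_eq_eRank, X.toFinite.cast_ncard_eq]⟩
  have hcard : ∀ J : Finset E, M.IsBase (J : Set E) → J.card = r := by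
    intro J h
    have := h.encard_eq_eRank
    rwa [hr, Set.encard_coe_eq_coe_finsetCard, Nat.cast_inj] at this
  refine (weaklyRepresentable_iff hM).2 ⟨r, fun I => f.toRingHom (Z I), fun I =>
    f.map_mon _ (toFoundation_mem _ _), fun X => ⟨fun hX => ?_, ?_⟩, fun I a b c' d hI => ?_⟩
  · have hX' : M.IsBase (X.toFinite.toFinset : Set E) := by simpa using hX
    exact ⟨⟨_, hcard _ hX'⟩, hZ1 _ hX', by simp⟩
  · rintro ⟨I, hI, rfl⟩
    by_contra h
    exact hI (hZ0 _ h)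
  · have hext : extendZero (fun I : {I : Finset E // I.card = r} => f.toRingHom (Z I)) =
        fun J => f.toRingHom (Z J) := by
      funext J
      unfold extendZero
      split_ifs with h
      · rfl
      · exact (hZ0 J fun h' => h (hcard J h')).symm
    rw [hext, ← he, ← map_pluckerExpr, ← map_zero f.toRingHom]
    refine f.map_le _ _ ?_
    have h₁ := map_pluckerExpr (weakUniversalPasture M).foundationIncl.toRingHom e Z I a b c' d
    have h₂ := map_pluckerExpr (toUniversalPasture M)
      (degreeZeroOf (epsMonomial M) degree_epsMonomial) Y I a b c' d
    change 0 ≤ (weakUniversalPasture M).foundationIncl.toRingHom (pluckerExpr e Z I a b c' d)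
    rw [h₁]
    refine le_of_le_of_eq ?_ h₂
    refine toUniversalPasture_nonneg ?_
    have h₃ := map_pluckerExpr (degreeZero M).subtype
      (degreeZeroOf (epsMonomial M) degree_epsMonomial) Y I a b c' d
    change 0 ≤ toPlucker M ((degreeZero M).subtype (pluckerExpr
      (degreeZeroOf (epsMonomial M) degree_epsMonomial) Y I a b c' d))
    rw [h₃]
    simp only [Subsemiring.subtype_apply, hYval]
    obtain ⟨-, hab, hbc, hcd, ha, hb, hc, hd⟩ := id hI
    have hs : ∀ x y, x ∉ I → y ∉ I → x ≠ y → s (I ∪ {x, y}) = s I * (w x * w y) := by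
      intro x y hx hy hxy
      simp only [s]
      rw [Finset.prod_union (by simp [hx, hy]), Finset.prod_pair hxy, mul_assoc]
    convert toPlucker_mul_nonneg (toPlucker_pluckerExpr hr hI)
      (MonoidAlgebra.of ℕ _ (s I * s I * (w a * w b * w c' * w d))⁻¹) using 2
    -- In each of the three products the two sets together cover `I` twice and `a, b, c', d` once,
    -- so all terms are divided by the same monomial.
    have hmul : ∀ J K : Finset E, s J * s K = s I * s I * (w a * w b * w c' * w d) →
        basisVar M J * MonoidAlgebra.of ℕ _ (s J)⁻¹ * (basisVar M K * MonoidAlgebra.of ℕ _ (s K)⁻¹) =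
        basisVar M J * basisVar M K *
          MonoidAlgebra.of ℕ _ (s I * s I * (w a * w b * w c' * w d))⁻¹ := by
      intro J K h
      rw [← h, mul_mul_mul_comm, ← map_mul, ← mul_inv]
    have hac := hab.trans hbc
    have hbd := hbc.trans hcd
    unfold pluckerExpr
    rw [hmul (I ∪ {a, b}), hmul (I ∪ {a, c'}), hmul (I ∪ {a, d}), add_mul, add_mul, mul_assoc (epsVar M)]
    · rfl
    · rw [hs a d ha hd (hac.trans hcd).ne, hs b c' hb hc hbc.ne, mul_mul_mul_comm]
      congr 1; ac_rfl
    · rw [hs a c' ha hc hac.ne, hs b d hb hd hbd.ne, mul_mul_mul_comm]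
      congr 1; ac_rfl
    · rw [hs a b ha hb hab.ne, hs c' d hc hd hcd.ne, mul_mul_mul_comm]
      congr 1; ac_rfl

end Universal

/-! ### The equivalence -/

theorem exists_eps_weakUniversalPasture {E : Type v} [LinearOrder E] (M : Matroid E) :
    ∃ e ∈ (weakUniversalPasture M).mon, 0 ≤ 1 + e := by
  refine ⟨_, degreeZeroOf_mem (epsMonomial M) degree_epsMonomial, ?_⟩
  rw [← map_one (toUniversalPasture M), ← map_add]
  exact toUniversalPasture_nonneg toPlucker_one_add_eps

theorem mainTheorem7 {E : Type v} [LinearOrder E] [Finite E] (M : Matroid E)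
    (hM : M.E = Set.univ) (F : OrderedBlueprint.{u}) (hF : F.IsPasture) :
    [WeaklyRepresentable M F,
      WeaklyRepresentable M F.foundation,
      Nonempty (Hom (matroidFoundation M) F)].TFAE := by
  tfae_have 1 → 3 := fun h => h.nonempty_hom hM hF
  tfae_have 3 → 2 := fun ⟨f⟩ => by
    obtain ⟨g⟩ := f.nonempty_foundation (exists_eps_weakUniversalPasture M) hF.pasteurized
    -- The construction is applied to `F.foundation` itself, for which `0 ≠ 1` and uniqueness of the
    -- weak inverse of `1` are inherited from `F`.
    refine WeaklyRepresentable.of_hom hM (fun h => hF.zero_ne_one ?_)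
      (fun e he h => hF.pasteurized.eq_eps_foundation he h) g
    have := congrArg F.foundationIncl.toRingHom h
    rwa [map_zero, map_one] at this
  tfae_have 2 → 1 := fun h => h.of_foundation hM hF.pasteurized
  tfae_finish
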